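/- **Setting.** Let $n\ge 1$ nodes minimize $f=\frac1n\sum_{i=1}^n f_i$ over $\mathbb{R}^d$, starting from a common point $x^{(0)}$. Let $L\ge 0$, $\Delta>0$, $\sigma\ge 0$, and assume: - $W\in\mathbb{R}^{n\times n}$ is nonnegative, primitive and column-stochastic, with equilibrium vector $\pi$ ($\pi_i>0$, $\sum_i\pi_i=1$, $W\pi=\pi$). Put $\kappa_\pi=\max_i\pi_i/\min_i\pi_i$ and $\beta_\pi=\|\mathrm{diag}(\sqrt\pi)^{-1}(W-\pi\mathbf 1^\top)\,\mathrm{diag}(\sqrt\pi)\|_2$, and assume $\beta_\pi<1$. - Every $f_i$ is differentiable with $\|\nabla f_i(x)-\nabla f_i(y)\|\le L\|x-y\|$ for all $x,y$; $f$ is bounded below and $f(x^{(0)})-\inf f\le\Delta$. - Node $i$ has an oracle $\nabla F_i(x;\xi_i)$ with $\xi_i\sim\mathcal D_i$, $\mathbb{E}[\nabla F_i(x;\xi_i)]=\nabla f_i(x)$ and $\mathbb{E}\|\nabla F_i(x;\xi_i)-\nabla f_i(x)\|^2\le\sigma^2$ for every $x$. All samples $\xi_i^{(k,r)}\sim\mathcal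 D_i$ (over nodes $i$, iterations $k$, batch indices $r$) are independent. **Algorithm (MG-Push-DIGing).** Let $$R=\left\lceil\frac{(1+\sqrt{7\ln\kappa_\pi})^2+(1+\sqrt{2\ln n})^2}{1-\beta_\pi}\right\rceil,\qquad T=(K+1)R .$$ Stack the local variables as rows. Start with $\mathbf x^{(0)}=\mathbf w^{(0)}=\mathbf 1(x^{(0)})^\top$, $v^{(0)}=\mathbf 1$, $\mathbf y^{(0)}=\mathbf g^{(0)}$ and iterate $$\mathbf x^{(k+1)}=W^R(\mathbf x^{(k)}-\gamma\mathbf y^{(k)}),\quad v^{(k+1)}=W^Rv^{(k)},\quad \mathbf w^{(k+1)}=\mathrm{diag}(v^{(k+1)})^{-1}\mathbf x^{(k+1)},\quad \mathbf y^{(k+1)}=W^R(\mathbf y^{(k)}+\mathbf g^{(k+1)}-\mathbf g^{(k)}),$$ where $g_i^{(k)}=\frac1R\sum_{r=1}^R\nabla F_i(w_i^{(k)};\xi_i^{(k,r)})$ and the products with $W^R$ are computed by $R$ rounds of multiplication by $W$. Let $\bar x^{(k)}=\frac1n\sum_i x_i^{(k)}$. **Theorem.** There is a universal constant $C>0$ such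 that, for every $K\ge 0$ and every $Y$, there is a step size $\gamma>0$ depending only on $n,K,L,\Delta,\sigma,\kappa_\pi,\beta_\pi,Y$ for which every instance as above with $\mathbb{E}\|\mathbf y^{(0)}\|_F^2\le Y$ satisfies $\mathbb{E}\|\nabla f(\bar x^{(k)})\|^2<\infty$ for $0\le k\le K$ and $$\frac1{K+1}\sum_{k=0}^K\mathbb{E}\left\|\nabla f(\bar x^{(k)})\right\|^2\le C\left(\frac{\sigma\sqrt{L\Delta}}{\sqrt{nT}}+\left(1+\ln n+\Big(\tfrac{Y}{nL\Delta}\Big)^{1/3}\right)\frac{(1+\ln\kappa_\pi)L\Delta}{(1-\beta_\pi)T}\right).$$ (For $L=0$ the right-hand side is read as $0$.) In particular, the average is $$\widetilde{\mathcal O}\left(\frac{\sigma\sqrt{L\Delta}}{\sqrt{nT}}+\frac{(1+\ln\kappa_\pi)L\Delta}{(1-\beta_\pi)T}\right),$$ where $\widetilde{\mathcal O}$ hides a factor $\ln n$ and the normalized size $Y/(nL\Delta)$ of the initial stochastic gradients. -/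

import Mathlib

open MeasureTheory ProbabilityTheory

noncomputable section

namespace PushDIGing

/-- The space of the decision variable. -/
abbrev Vec (d : ℕ) := EuclideanSpace ℝ (Fin d)

/-! ### Mixing matrices and their two metrics -/

/-- A nonnegative, primitive, column-stochastic matrix. -/
structure IsMixingMatrix {n : ℕ} (W : Matrix (Fin n) (Fin n) ℝ) : Prop where
  nonneg : ∀ i j, 0 ≤ W i j
  primitive : W.IsPrimitive
  colSum : ∀ j, ∑ i, W i j = 1

/-- `π` is the equilibrium (Perron) vector of `W`. -/
structure IsEquilibrium {n : ℕ} (W : Matrix (Fin n) (Fin n) ℝ) (π : Fin n → ℝ) : Prop where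
  pos : ∀ i, 0 < π i
  sum_eq_one : ∑ i, π i = 1
  fixed : W.mulVec π = π

/-- The matrix `π`-norm `‖diag(√π)⁻¹ A diag(√π)‖₂`, with the spectral norm. -/
def piNorm {n : ℕ} (π : Fin n → ℝ) (A : Matrix (Fin n) (Fin n) ℝ) : ℝ :=
  ‖Matrix.toEuclideanCLM (𝕜 := ℝ)
    (Matrix.diagonal (fun i => (√(π i))⁻¹) * A * Matrix.diagonal (fun i => √(π i)))‖

/-- `β_π = ‖W - π 1ᵀ‖_π`; the generalized spectral gap is `1 - β_π`. -/
def betaPi {n : ℕ} (W : Matrix (Fin n) (Fin n) ℝ) (π : Fin n → ℝ) : ℝ :=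
  piNorm π (W - Matrix.of fun i _ => π i)

/-- The equilibrium skewness `κ_π = max π / min π`. -/
def kappaPi {n : ℕ} (π : Fin n → ℝ) : ℝ := (⨆ i, π i) / (⨅ i, π i)

/-- The number `R` of gossip rounds, which is also the batch size. -/
def gossipRounds (n : ℕ) (κ β : ℝ) : ℕ :=
  ⌈((1 + √(7 * Real.log κ)) ^ 2 + (1 + √(2 * Real.log n)) ^ 2) / (1 - β)⌉₊

/-! ### Objective functions and stochastic gradients -/

/-- The global objective `f = (1/n) ∑ f_i`. -/
def globalObj {n d : ℕ} (f : Fin n → Vec d → ℝ) (x : Vec d) : ℝ := (n : ℝ)⁻¹ * ∑ i, f i x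

/-- Every `f_i` has an `L`-Lipschitz gradient, `f` is bounded below, and
`f(x⁽⁰⁾) - inf f ≤ Δ`. -/
structure IsSmoothProblem {n d : ℕ} (f : Fin n → Vec d → ℝ) (x0 : Vec d) (L Δ : ℝ) : Prop where
  differentiable : ∀ i, Differentiable ℝ (f i)
  lipschitz : ∀ i x y, ‖gradient (f i) x - gradient (f i) y‖ ≤ L * ‖x - y‖
  bddBelow : BddBelow (Set.range (globalObj f))
  gap : globalObj f x0 - ⨅ x, globalObj f x ≤ Δ

/-- `G x s` (for a sample `s` with law `D`) is an unbiased stochastic gradient of `h` at `x`, with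
variance at most `σ²`. -/
structure IsGradientOracle {d : ℕ} {Ξ : Type*} [MeasurableSpace Ξ] (h : Vec d → ℝ)
    (D : Measure Ξ) (G : Vec d → Ξ → Vec d) (σ : ℝ) : Prop where
  measurable : Measurable (Function.uncurry G)
  integrable : ∀ x, Integrable (G x) D
  unbiased : ∀ x, ∫ s, G x s ∂D = gradient h x
  integrable_sq : ∀ x, Integrable (fun s => ‖G x s - gradient h x‖ ^ 2) D
  variance_le : ∀ x, ∫ s, ‖G x s - gradient h x‖ ^ 2 ∂D ≤ σ ^ 2

/-- The samples `ξ i k r` (node `i`, iteration `k`, index `r` in the batch) are independent, and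
those of node `i` have law `D i`. -/
structure IsSampling {n : ℕ} {Ω Ξ : Type*} [MeasurableSpace Ω] [MeasurableSpace Ξ]
    (μ : Measure Ω) (D : Fin n → Measure Ξ) (ξ : Fin n → ℕ → ℕ → Ω → Ξ) : Prop where
  measurable : ∀ i k r, Measurable (ξ i k r)
  law : ∀ i k r, μ.map (ξ i k r) = D i
  indep : iIndepFun (fun p : Fin n × ℕ × ℕ => ξ p.1 p.2.1 p.2.2) μ

/-! ### The algorithm -/

/-- One round of communication: node `i` receives `∑ j, w_ij z_j`. -/
def wProtocol {n : ℕ} {M : Type*} [AddCommMonoid M] [Module ℝ M]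
    (W : Matrix (Fin n) (Fin n) ℝ) (z : Fin n → M) : Fin n → M :=
  fun i => ∑ j, W i j • z j

/-- `R` successive rounds of communication. -/
def gossip {n : ℕ} {M : Type*} [AddCommMonoid M] [Module ℝ M]
    (W : Matrix (Fin n) (Fin n) ℝ) (R : ℕ) (z : Fin n → M) : Fin n → M :=
  (wProtocol W)^[R] z

/-- The local variables of all nodes: models `x`, push-sum weights `v`, corrected models `w`,
stochastic gradients `g`, gradient trackers `y`. -/
structure State (n d : ℕ) where
  x : Fin n → Vec d
  v : Fin n → ℝ
  w : Fin n → Vec d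
  g : Fin n → Vec d
  y : Fin n → Vec d

/-- Averages of `R` stochastic gradients, at iteration `k`, node `i` being queried at `w i`. -/
def batchGrad {n d : ℕ} {Ω Ξ : Type*} (R : ℕ) (G : Fin n → Vec d → Ξ → Vec d)
    (ξ : Fin n → ℕ → ℕ → Ω → Ξ) (ω : Ω) (k : ℕ) (w : Fin n → Vec d) : Fin n → Vec d :=
  fun i => (R : ℝ)⁻¹ • ∑ r ∈ Finset.range R, G i (w i) (ξ i k r ω)

/-- MG-Push-DIGing with mixing matrix `W`, `R` gossip rounds per step, batch size `R`, step size
`γ` and common starting point `x0`: the state after `k` iterations. -/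
def mgPushDIGing {n d : ℕ} {Ω Ξ : Type*} (W : Matrix (Fin n) (Fin n) ℝ) (R : ℕ) (γ : ℝ)
    (x0 : Vec d) (G : Fin n → Vec d → Ξ → Vec d) (ξ : Fin n → ℕ → ℕ → Ω → Ξ) (ω : Ω) :
    ℕ → State n d
  | 0 =>
    let g := batchGrad R G ξ ω 0 (fun _ => x0)
    { x := fun _ => x0, v := fun _ => 1, w := fun _ => x0, g := g, y := g }
  | k + 1 =>
    let s := mgPushDIGing W R γ x0 G ξ ω k
    let x := gossip W R (fun i => s.x i - γ • s.y i)
    let v := gossip W R s.v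
    let w := fun i => (v i)⁻¹ • x i
    let g := batchGrad R G ξ ω (k + 1) w
    { x := x, v := v, w := w, g := g, y := gossip W R (fun i => s.y i + g i - s.g i) }

/-- The network average `x̄ = (1/n) ∑ x_i`. -/
def State.avg {n d : ℕ} (s : State n d) : Vec d := (n : ℝ)⁻¹ • ∑ i, s.x i

/-- The expected squared Frobenius norm `E‖y⁽⁰⁾‖_F²` of the initial stochastic gradients. -/
def initGradSq {n d : ℕ} {Ω Ξ : Type*} [MeasurableSpace Ω] (μ : Measure Ω) (R : ℕ) (x0 : Vec d)
    (G : Fin n → Vec d → Ξ → Vec d) (ξ : Fin n → ℕ → ℕ → Ω → Ξ) : ℝ :=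
  ∫ ω, ∑ i, ‖batchGrad R G ξ ω 0 (fun _ => x0) i‖ ^ 2 ∂μ

end PushDIGing

end

/-! Column-stochasticity preserves sums, so the network average obeys a perturbed gradient step:
`x̄⁺ = x̄ - γ ḡ`, where `ḡ` averages the local stochastic gradients. Expected descent on `f` then
leaves three costs: the noise of `ḡ`, the consensus error `∑ ‖w_i - x̄‖²`, and the starting gap `Δ`.

The consensus error is controlled in the `π`-norm. On zero-sum stacks one multiplication by `W`
contracts by `β`, hence `R` rounds contract by `ρ = β^R ≤ exp (-(1-β) R)`. With `P = n κ ≥ 1/π_i`,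
the choice of `R` gives `ρ P n ≤ 1/7` (`pow_gossipRounds_le`). This one inequality keeps the
push-sum weights above `6/7 · n π_i` after the first step and beats every factor `P` lost in passing
between the `π`-norm and the Euclidean one. The disagreements of models and trackers therefore
satisfy coupled linear recursions with small coefficients. Summed over time, they bound the
consensus error by `γ²` times the initial gradients, the local noise and a small multiple of `∑
‖ḡ‖²` (`consensus_bound_of_recursion`).

The term `-γ/2 ‖meanGrad‖²` in the descent inequality absorbs the exact-gradient part of `∑ ‖ḡ‖²`,
giving a bound for every realization (`GossipBounds.sum_norm_gradient_sq_le`). In expectation the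
inner product with the noise vanishes, because each sample is independent of all the others and
hence of its query point. By the same orthogonality the averaged noise has second moment at most
`σ²/(nR)`. What remains is `2Δ/γ + 4γ²L²Y/n⁵ + 8γL(K+1)σ²/(nR)`. A harmonic-sum step size balances
its terms, and the upper bound on `R` converts `1/(K+1)` into `1/T`. -/

namespace PushDIGing

section Gossip

variable {n d : ℕ} {W : Matrix (Fin n) (Fin n) ℝ} {π : Fin n → ℝ}

/-! ### Linearity of gossip -/

section Module

variable {M : Type*} [AddCommGroup M] [Module ℝ M]

theorem wProtocol_sub (a b : Fin n → M) :
    wProtocol W (a - b) = wProtocol W a - wProtocol W b := by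
  ext i
  simp [wProtocol, smul_sub]

theorem wProtocol_smul_const (v : Fin n → ℝ) (x : M) :
    wProtocol W (fun i => v i • x) = fun i => wProtocol W v i • x := by
  ext i
  simp [wProtocol, Finset.sum_smul, smul_smul]

theorem sum_wProtocol (hW : IsMixingMatrix W) (z : Fin n → M) :
    ∑ i, wProtocol W z i = ∑ i, z i := by
  simp only [wProtocol]
  rw [Finset.sum_comm]
  simp [← Finset.sum_smul, hW.colSum]

theorem gossip_succ (R : ℕ) (z : Fin n → M) :
    gossip W (R + 1) z = wProtocol W (gossip W R z) := by
  simp only [gossip, Function.iterate_succ_apply']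

theorem gossip_sub (R : ℕ) (a b : Fin n → M) :
    gossip W R (a - b) = gossip W R a - gossip W R b := by
  induction R with
  | zero => rfl
  | succ R ih => rw [gossip_succ, ih, wProtocol_sub, gossip_succ, gossip_succ]

theorem gossip_smul_const (R : ℕ) (v : Fin n → ℝ) (x : M) :
    gossip W R (fun i => v i • x) = fun i => gossip W R v i • x := by
  induction R with
  | zero => rfl
  | succ R ih => rw [gossip_succ, ih, wProtocol_smul_const, gossip_succ]

theorem sum_gossip (hW : IsMixingMatrix W) (R : ℕ) (z : Fin n → M) :
    ∑ i, gossip W R z i = ∑ i, z i := by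
  induction R with
  | zero => rfl
  | succ R ih => rw [gossip_succ, sum_wProtocol hW, ih]

end Module

theorem gossip_equilibrium (hπ : IsEquilibrium W π) (R : ℕ) (c : ℝ) :
    gossip W R (fun i => c * π i) = fun i => c * π i := by
  induction R with
  | zero => rfl
  | succ R ih =>
    rw [gossip_succ, ih]
    ext i
    have h := congrFun hπ.fixed i
    simp only [Matrix.mulVec, dotProduct] at h
    simp only [wProtocol, smul_eq_mul]
    rw [← h, Finset.mul_sum]
    exact Finset.sum_congr rfl fun j _ => by ring

/-! ### The weighted norm and its contraction -/

/-- The squared vector `π`-norm `∑ i, ‖z i‖² / π i`. -/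
noncomputable def piSq {E : Type*} [Norm E] (π : Fin n → ℝ) (z : Fin n → E) : ℝ :=
  ∑ i, ‖z i‖ ^ 2 / π i

theorem piSq_nonneg {E : Type*} [SeminormedAddCommGroup E] (hπ : ∀ i, 0 < π i) (z : Fin n → E) :
    0 ≤ piSq π z :=
  Finset.sum_nonneg fun i _ => div_nonneg (sq_nonneg _) (hπ i).le

/-- On zero-sum vectors `π 1ᵀ` vanishes, so `W` acts as `W - π 1ᵀ`; conjugation by `diag(√π)` turns
the `π`-norm into the Euclidean norm, and `betaPi` is by definition the resulting operator norm. -/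
theorem piSq_wProtocol_real (hπ : ∀ i, 0 < π i) (z : Fin n → ℝ) (hz : ∑ i, z i = 0) :
    piSq π (wProtocol W z) ≤ betaPi W π ^ 2 * piSq π z := by
  set A : Matrix (Fin n) (Fin n) ℝ := Matrix.diagonal (fun i => (√(π i))⁻¹) *
    (W - Matrix.of fun i _ => π i) * Matrix.diagonal (fun i => √(π i)) with hA
  have key := (Matrix.toEuclideanCLM (𝕜 := ℝ) A).le_opNorm
    (WithLp.toLp 2 fun i => (√(π i))⁻¹ * z i)
  have hs : ∀ i, √(π i) ≠ 0 := fun i => (Real.sqrt_pos.2 (hπ i)).ne'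
  have hAz : Matrix.toEuclideanCLM (𝕜 := ℝ) A (WithLp.toLp 2 fun i => (√(π i))⁻¹ * z i) =
      WithLp.toLp 2 fun i => (√(π i))⁻¹ * wProtocol W z i := by
    rw [Matrix.toEuclideanCLM_toLp]
    congr 1
    ext i
    simp only [hA, Matrix.mulVec, dotProduct, Matrix.mul_diagonal, Matrix.diagonal_mul,
      Matrix.sub_apply, Matrix.of_apply, wProtocol, smul_eq_mul]
    have : ∀ j, (√(π i))⁻¹ * (W i j - π i) * √(π j) * ((√(π j))⁻¹ * z j) =
        (√(π i))⁻¹ * (W i j * z j) - (√(π i))⁻¹ * π i * z j := fun j => by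
      have := hs j
      field_simp
    simp only [this]
    rw [Finset.sum_sub_distrib, ← Finset.mul_sum, ← Finset.mul_sum, hz]
    ring
  have hn : ∀ u : Fin n → ℝ, ‖(WithLp.toLp 2 fun i => (√(π i))⁻¹ * u i :
      EuclideanSpace ℝ (Fin n))‖ ^ 2 = piSq π u := fun u => by
    rw [EuclideanSpace.norm_sq_eq]
    refine Finset.sum_congr rfl fun i _ => ?_
    simp only [norm_mul, mul_pow, Real.norm_eq_abs, sq_abs, inv_pow]
    rw [Real.sq_sqrt (hπ i).le]
    ring
  rw [hAz] at key
  rw [← hn, ← hn, ← mul_pow]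
  exact pow_le_pow_left₀ (norm_nonneg _) key 2

theorem piSq_wProtocol_vec (hπ : ∀ i, 0 < π i) (z : Fin n → Vec d) (hz : ∑ i, z i = 0) :
    piSq π (wProtocol W z) ≤ betaPi W π ^ 2 * piSq π z := by
  have h : ∀ u : Fin n → Vec d, piSq π u = ∑ c, piSq π fun i => u i c := fun u => by
    simp only [piSq, EuclideanSpace.norm_sq_eq]
    rw [Finset.sum_comm]
    simp only [Finset.sum_div]
  rw [h, h, Finset.mul_sum]
  refine Finset.sum_le_sum fun c _ => ?_
  have hc : (fun i => wProtocol W z i c) = wProtocol W fun i => z i c := by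
    ext i
    simp [wProtocol]
  rw [hc]
  refine piSq_wProtocol_real hπ _ ?_
  have := congrArg (fun u : Vec d => u c) hz
  simpa using this

theorem piSq_gossip_le {M : Type*} [NormedAddCommGroup M] [Module ℝ M] (hW : IsMixingMatrix W)
    {b : ℝ} (h : ∀ z : Fin n → M, ∑ i, z i = 0 → piSq π (wProtocol W z) ≤ b ^ 2 * piSq π z)
    (R : ℕ) (z : Fin n → M) (hz : ∑ i, z i = 0) :
    piSq π (gossip W R z) ≤ (b ^ R) ^ 2 * piSq π z := by
  induction R with
  | zero => simp [gossip]
  | succ R ih =>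
    rw [gossip_succ]
    refine (h _ ((sum_gossip hW R z).trans hz)).trans ?_
    calc b ^ 2 * piSq π (gossip W R z) ≤ b ^ 2 * ((b ^ R) ^ 2 * piSq π z) := by gcongr
      _ = (b ^ (R + 1)) ^ 2 * piSq π z := by ring

theorem piSq_sub_le (hπ : ∀ i, 0 < π i) (a b : Fin n → Vec d) :
    piSq π (a - b) ≤ 2 * (piSq π a + piSq π b) := by
  simp only [piSq, ← Finset.sum_add_distrib, Finset.mul_sum]
  refine Finset.sum_le_sum fun i _ => ?_
  rw [← add_div, ← mul_div_assoc]
  have := (hπ i).le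
  gcongr
  have h1 := norm_sub_le (a i) (b i)
  have h2 := pow_le_pow_left₀ (norm_nonneg _) h1 2
  rw [Pi.sub_apply]
  nlinarith [sq_nonneg (‖a i‖ - ‖b i‖)]

theorem piSq_smul_const (v : Fin n → ℝ) (x : Vec d) :
    piSq π (fun i => v i • x) = piSq π v * ‖x‖ ^ 2 := by
  simp only [piSq, Finset.sum_mul, norm_smul, mul_pow]
  exact Finset.sum_congr rfl fun i _ => by ring

theorem piSq_le_of_inv_le {E : Type*} [SeminormedAddCommGroup E] {P : ℝ} (hP : ∀ i, (π i)⁻¹ ≤ P)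
    (z : Fin n → E) : piSq π z ≤ P * ∑ i, ‖z i‖ ^ 2 := by
  rw [piSq, Finset.mul_sum]
  refine Finset.sum_le_sum fun i _ => ?_
  rw [div_eq_inv_mul]
  gcongr
  exact hP i

/-- Cauchy–Schwarz for averages. -/
theorem norm_avg_sq_le {E : Type*} [NormedAddCommGroup E] [NormedSpace ℝ E] (hn : 1 ≤ n)
    (a : Fin n → E) : (n : ℝ) * ‖(n : ℝ)⁻¹ • ∑ i, a i‖ ^ 2 ≤ ∑ i, ‖a i‖ ^ 2 := by
  have hn' : (0 : ℝ) < n := by exact_mod_cast hn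
  have h1 : ‖∑ i, a i‖ ^ 2 ≤ n * ∑ i, ‖a i‖ ^ 2 := by
    calc ‖∑ i, a i‖ ^ 2 ≤ (∑ i, ‖a i‖) ^ 2 := by
          gcongr
          exact norm_sum_le _ _
      _ ≤ n * ∑ i, ‖a i‖ ^ 2 := by
          simpa using sq_sum_le_card_mul_sum_sq (s := Finset.univ) (f := fun i => ‖a i‖)
  rw [norm_smul, mul_pow, norm_inv, Real.norm_of_nonneg hn'.le]
  calc (n : ℝ) * ((n : ℝ)⁻¹ ^ 2 * ‖∑ i, a i‖ ^ 2)
      ≤ (n : ℝ) * ((n : ℝ)⁻¹ ^ 2 * (n * ∑ i, ‖a i‖ ^ 2)) := by gcongr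
    _ = ∑ i, ‖a i‖ ^ 2 := by field_simp

/-- The projection along `v` onto vectors of zero sum is bounded from the Frobenius norm to the
`π`-norm. -/
theorem piSq_sub_smul_avg_le (hn : 1 ≤ n) (hπ : ∀ i, 0 < π i) {P : ℝ} (hP : ∀ i, (π i)⁻¹ ≤ P)
    {v : Fin n → ℝ} (hv : piSq π v ≤ n * P) (a : Fin n → Vec d) :
    piSq π (a - fun i => v i • ((n : ℝ)⁻¹ • ∑ j, a j)) ≤ 4 * P * ∑ i, ‖a i‖ ^ 2 := by
  have hP0 : 0 ≤ P := (inv_nonneg.2 (hπ ⟨0, hn⟩).le).trans (hP ⟨0, hn⟩)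
  have h1 := piSq_sub_le hπ a (fun i => v i • ((n : ℝ)⁻¹ • ∑ j, a j))
  rw [piSq_smul_const] at h1
  have h2 := piSq_le_of_inv_le hP a
  have h3 : piSq π v * ‖(n : ℝ)⁻¹ • ∑ j, a j‖ ^ 2 ≤ P * ∑ i, ‖a i‖ ^ 2 := by
    calc piSq π v * ‖(n : ℝ)⁻¹ • ∑ j, a j‖ ^ 2 ≤ n * P * ‖(n : ℝ)⁻¹ • ∑ j, a j‖ ^ 2 := by gcongr
      _ = P * (n * ‖(n : ℝ)⁻¹ • ∑ j, a j‖ ^ 2) := by ring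
      _ ≤ _ := by gcongr; exact norm_avg_sq_le hn a
  linarith

end Gossip

end PushDIGing

namespace PushDIGing

section Smooth

variable {n d : ℕ} {f : Fin n → Vec d → ℝ} {x0 : Vec d} {L Δ : ℝ}

/-! ### Smooth objectives -/

theorem hasGradientAt_globalObj (hf : ∀ i, Differentiable ℝ (f i)) (x : Vec d) :
    HasGradientAt (globalObj f) ((n : ℝ)⁻¹ • ∑ i, gradient (f i) x) x := by
  have h : HasFDerivAt (fun y => (n : ℝ)⁻¹ * ∑ i, f i y) ((n : ℝ)⁻¹ • ∑ i, fderiv ℝ (f i) x) x :=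
    (HasFDerivAt.fun_sum fun i _ => (hf i x).hasFDerivAt).const_mul _
  rw [hasGradientAt_iff_hasFDerivAt]
  have h2 : InnerProductSpace.toDual ℝ (Vec d) ((n : ℝ)⁻¹ • ∑ i, gradient (f i) x) =
      (n : ℝ)⁻¹ • ∑ i, fderiv ℝ (f i) x := by
    simp [gradient]
  rw [h2]
  exact h

theorem gradient_globalObj (hf : ∀ i, Differentiable ℝ (f i)) (x : Vec d) :
    gradient (globalObj f) x = (n : ℝ)⁻¹ • ∑ i, gradient (f i) x :=
  (hasGradientAt_globalObj hf x).gradient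

theorem norm_avg_le_of_forall_le {E : Type*} [NormedAddCommGroup E] [NormedSpace ℝ E] (hn : 1 ≤ n)
    {a : Fin n → E} {c : ℝ} (h : ∀ i, ‖a i‖ ≤ c) : ‖(n : ℝ)⁻¹ • ∑ i, a i‖ ≤ c := by
  have hn' : (0 : ℝ) < n := by exact_mod_cast hn
  rw [norm_smul, norm_inv, Real.norm_of_nonneg hn'.le, inv_mul_le_iff₀ hn']
  refine (norm_sum_le _ _).trans ((Finset.sum_le_sum fun i _ => h i).trans ?_)
  simp

theorem IsSmoothProblem.lipschitz_globalObj (hf : IsSmoothProblem f x0 L Δ) (hn : 1 ≤ n)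
    (x y : Vec d) :
    ‖gradient (globalObj f) x - gradient (globalObj f) y‖ ≤ L * ‖x - y‖ := by
  rw [gradient_globalObj hf.differentiable, gradient_globalObj hf.differentiable, ← smul_sub,
    ← Finset.sum_sub_distrib]
  exact norm_avg_le_of_forall_le hn fun i => hf.lipschitz i x y

/-- The mean value theorem along the segment suffices. It gives `L` in place of the sharp `L / 2`,
which costs only in the universal constant. -/
theorem IsSmoothProblem.descent (hf : IsSmoothProblem f x0 L Δ) (hn : 1 ≤ n) (hL : 0 ≤ L)
    (x p : Vec d) : globalObj f (x + p) ≤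
      globalObj f x + inner ℝ (gradient (globalObj f) x) p + L * ‖p‖ ^ 2 := by
  set F := globalObj f
  have hF : ∀ y, HasFDerivAt F (InnerProductSpace.toDual ℝ _ (gradient F y)) y := fun y =>
    (hasGradientAt_globalObj hf.differentiable y).differentiableAt.hasGradientAt.hasFDerivAt
  have hφ : ∀ t : ℝ, HasDerivAt (fun t : ℝ => F (x + t • p)) (inner ℝ (gradient F (x + t • p)) p)
      t := fun t => by
    have h1 : HasDerivAt (fun t : ℝ => x + t • p) p t := by
      simpa using ((hasDerivAt_id t).smul_const p).const_add x
    have h2 := (hF (x + t • p)).comp_hasDerivAt t h1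
    rw [InnerProductSpace.toDual_apply_apply] at h2
    exact h2
  obtain ⟨t, ht, h⟩ := exists_hasDerivAt_eq_slope (fun t : ℝ => F (x + t • p)) _ zero_lt_one
    (fun t _ => (hφ t).continuousAt.continuousWithinAt) fun t _ => hφ t
  simp only [one_smul, zero_smul, add_zero, sub_zero, div_one] at h
  have h2 : inner ℝ (gradient F (x + t • p) - gradient F x) p ≤ L * ‖p‖ ^ 2 := by
    have h3 : ‖gradient F (x + t • p) - gradient F x‖ ≤ L * ‖p‖ := by
      refine (hf.lipschitz_globalObj hn _ _).trans ?_
      rw [add_sub_cancel_left, norm_smul, Real.norm_of_nonneg ht.1.le]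
      have := mul_le_of_le_one_left (norm_nonneg p) ht.2.le
      gcongr
    calc _ ≤ ‖gradient F (x + t • p) - gradient F x‖ * ‖p‖ := real_inner_le_norm _ _
      _ ≤ L * ‖p‖ * ‖p‖ := by gcongr
      _ = _ := by ring
  rw [inner_sub_left] at h2
  linarith

end Smooth

section Iteration

variable {n d : ℕ} {W : Matrix (Fin n) (Fin n) ℝ} {R : ℕ} {γ : ℝ} {x0 : Vec d}
  {s : ℕ → State n d}

/-! ### The iteration, along one realization of the samples -/

/-- The sequence of states `s` follows the push-DIGing recursion, with arbitrary gradients `g`. -/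
structure IsPushDIGing (W : Matrix (Fin n) (Fin n) ℝ) (R : ℕ) (γ : ℝ) (x0 : Vec d)
    (s : ℕ → State n d) : Prop where
  x_zero : (s 0).x = fun _ => x0
  v_zero : (s 0).v = fun _ => 1
  w_zero : (s 0).w = fun _ => x0
  y_zero : (s 0).y = (s 0).g
  x_succ : ∀ k, (s (k + 1)).x = gossip W R fun i => (s k).x i - γ • (s k).y i
  v_succ : ∀ k, (s (k + 1)).v = gossip W R (s k).v
  w_succ : ∀ k, (s (k + 1)).w = fun i => ((s (k + 1)).v i)⁻¹ • (s (k + 1)).x i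
  y_succ : ∀ k, (s (k + 1)).y = gossip W R fun i => (s k).y i + (s (k + 1)).g i - (s k).g i

theorem isPushDIGing_mgPushDIGing {Ω Ξ : Type*} (W : Matrix (Fin n) (Fin n) ℝ) (R : ℕ) (γ : ℝ)
    (x0 : Vec d) (G : Fin n → Vec d → Ξ → Vec d) (ξ : Fin n → ℕ → ℕ → Ω → Ξ) (ω : Ω) :
    IsPushDIGing W R γ x0 (mgPushDIGing W R γ x0 G ξ ω) :=
  ⟨rfl, rfl, rfl, rfl, fun _ => rfl, fun _ => rfl, fun _ => rfl, fun _ => rfl⟩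

/-- The network average of the local gradients. -/
noncomputable def State.avgGrad (s : State n d) : Vec d := (n : ℝ)⁻¹ • ∑ i, s.g i

/-- The disagreement of the models. -/
noncomputable def State.disagreement (s : State n d) : Fin n → Vec d :=
  s.x - fun i => s.v i • s.avg

/-- The disagreement of the gradient trackers. -/
noncomputable def State.trackDisagreement (s : State n d) : Fin n → Vec d :=
  s.y - fun i => s.v i • s.avgGrad

/-- The consensus error of the corrected models. -/
noncomputable def State.consensusSq (s : State n d) : ℝ := ∑ i, ‖s.w i - s.avg‖ ^ 2

namespace IsPushDIGing

theorem sum_v (hs : IsPushDIGing W R γ x0 s) (hW : IsMixingMatrix W) (k : ℕ) :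
    ∑ i, (s k).v i = n := by
  induction k with
  | zero => simp [hs.v_zero]
  | succ k ih => rw [hs.v_succ, sum_gossip hW, ih]

theorem sum_y (hs : IsPushDIGing W R γ x0 s) (hW : IsMixingMatrix W) (k : ℕ) :
    ∑ i, (s k).y i = ∑ i, (s k).g i := by
  induction k with
  | zero => rw [hs.y_zero]
  | succ k ih =>
    rw [hs.y_succ, sum_gossip hW, Finset.sum_sub_distrib, Finset.sum_add_distrib, ih]
    abel

theorem avg_succ (hs : IsPushDIGing W R γ x0 s) (hW : IsMixingMatrix W) (k : ℕ) :
    (s (k + 1)).avg = (s k).avg - γ • (s k).avgGrad := by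
  rw [State.avg, hs.x_succ, sum_gossip hW, Finset.sum_sub_distrib, ← Finset.smul_sum,
    hs.sum_y hW, smul_sub, State.avg, State.avgGrad, smul_comm γ]

theorem avg_zero (hs : IsPushDIGing W R γ x0 s) (hn : 1 ≤ n) : (s 0).avg = x0 := by
  have hn' : (n : ℝ) ≠ 0 := by positivity
  simp only [State.avg, hs.x_zero, Finset.sum_const, Finset.card_univ, Fintype.card_fin]
  rw [← Nat.cast_smul_eq_nsmul ℝ, smul_smul, inv_mul_cancel₀ hn', one_smul]

theorem sum_disagreement (hs : IsPushDIGing W R γ x0 s) (hW : IsMixingMatrix W) (hn : 1 ≤ n)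
    (k : ℕ) : ∑ i, (s k).disagreement i = 0 := by
  have hn' : (n : ℝ) ≠ 0 := by positivity
  simp only [State.disagreement, Pi.sub_apply, Finset.sum_sub_distrib, ← Finset.sum_smul,
    hs.sum_v hW, State.avg]
  rw [smul_smul, mul_inv_cancel₀ hn', one_smul, sub_self]

theorem sum_trackDisagreement (hs : IsPushDIGing W R γ x0 s) (hW : IsMixingMatrix W) (hn : 1 ≤ n)
    (k : ℕ) : ∑ i, (s k).trackDisagreement i = 0 := by
  have hn' : (n : ℝ) ≠ 0 := by positivity
  simp only [State.trackDisagreement, Pi.sub_apply, Finset.sum_sub_distrib, ← Finset.sum_smul,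
    hs.sum_v hW, State.avgGrad, hs.sum_y hW]
  rw [smul_smul, mul_inv_cancel₀ hn', one_smul, sub_self]

theorem disagreement_zero (hs : IsPushDIGing W R γ x0 s) (hn : 1 ≤ n) :
    (s 0).disagreement = 0 := by
  ext1 i
  simp [State.disagreement, hs.x_zero, hs.v_zero, hs.avg_zero hn]

theorem disagreement_succ (hs : IsPushDIGing W R γ x0 s) (hW : IsMixingMatrix W) (k : ℕ) :
    (s (k + 1)).disagreement =
      gossip W R ((s k).disagreement - γ • (s k).trackDisagreement) := by
  rw [State.disagreement, hs.avg_succ hW, hs.x_succ, hs.v_succ, ← gossip_smul_const, ← gossip_sub]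
  congr 1
  ext1 i
  simp only [State.disagreement, State.trackDisagreement, Pi.sub_apply, Pi.smul_apply]
  module

/-- The new gradients enter only through their change between two iterations, projected along `v`
onto zero-sum stacks. The change is written as a subtracted term to fit `piSq_sub_le`. -/
theorem trackDisagreement_succ (hs : IsPushDIGing W R γ x0 s) (k : ℕ) :
    (s (k + 1)).trackDisagreement = gossip W R ((s k).trackDisagreement -
      (((s k).g - (s (k + 1)).g) -
        fun i => (s k).v i • ((n : ℝ)⁻¹ • ∑ j, ((s k).g - (s (k + 1)).g) j))) := by
  rw [State.trackDisagreement, hs.y_succ, hs.v_succ, ← gossip_smul_const, ← gossip_sub]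
  congr 1
  ext1 i
  simp only [State.trackDisagreement, State.avgGrad, Pi.sub_apply, Finset.sum_sub_distrib]
  module

end IsPushDIGing

/-! ### Bounds on the consensus error -/

/-- What `R` rounds of gossip achieve: contraction by `ρ` in the `π`-norm, where `ρ` is small
against the size `P` of the inverse weights. -/
structure GossipBounds (W : Matrix (Fin n) (Fin n) ℝ) (π : Fin n → ℝ) (R : ℕ) (ρ P : ℝ) :
    Prop where
  mixing : IsMixingMatrix W
  equilibrium : IsEquilibrium W π
  contract_real : ∀ z : Fin n → ℝ, ∑ i, z i = 0 → piSq π (gossip W R z) ≤ ρ ^ 2 * piSq π z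
  contract_vec : ∀ (d : ℕ) (z : Fin n → Vec d), ∑ i, z i = 0 →
    piSq π (gossip W R z) ≤ ρ ^ 2 * piSq π z
  inv_le : ∀ i, (π i)⁻¹ ≤ P
  nonneg : 0 ≤ ρ
  small : ρ * P * n ≤ 1 / 7
  card_pos : 1 ≤ n
  card_le : (n : ℝ) ≤ P

namespace GossipBounds

variable {π : Fin n → ℝ} {ρ P : ℝ}

theorem le_one (h : GossipBounds W π R ρ P) : ρ ≤ 1 / 7 := by
  have h1 : (1 : ℝ) ≤ n := by exact_mod_cast h.card_pos
  have h2 : 1 ≤ P * n := one_le_mul_of_one_le_of_one_le (h1.trans h.card_le) h1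
  have := h.small
  nlinarith [h.nonneg]

/-- Pythagoras: the `π`-inner product with `π` is the plain sum, so the zero-sum deviation `v - n π`
is orthogonal to `n π`. -/
theorem piSq_eq_add (h : GossipBounds W π R ρ P) {v : Fin n → ℝ} (hv : ∑ i, v i = n) :
    piSq π v = (n : ℝ) ^ 2 + piSq π (fun i => v i - n * π i) := by
  have h1 : ∀ i, ‖v i - n * π i‖ ^ 2 / π i = ‖v i‖ ^ 2 / π i - 2 * n * v i + n ^ 2 * π i :=
    fun i => by
      have := (h.equilibrium.pos i).ne'
      simp only [Real.norm_eq_abs, sq_abs]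
      field_simp
      ring
  simp only [piSq, h1, Finset.sum_add_distrib, Finset.sum_sub_distrib, ← Finset.mul_sum, hv,
    h.equilibrium.sum_eq_one]
  ring

theorem sum_deviation (h : GossipBounds W π R ρ P) (hs : IsPushDIGing W R γ x0 s) (k : ℕ) :
    ∑ i, ((s k).v i - n * π i) = 0 := by
  rw [Finset.sum_sub_distrib, hs.sum_v h.mixing, ← Finset.mul_sum, h.equilibrium.sum_eq_one]
  ring

theorem deviation_succ (h : GossipBounds W π R ρ P) (hs : IsPushDIGing W R γ x0 s) (k : ℕ) :
    piSq π (fun i => (s (k + 1)).v i - n * π i) ≤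
      ρ ^ 2 * piSq π (fun i => (s k).v i - n * π i) := by
  have h1 : (fun i => (s (k + 1)).v i - n * π i) =
      gossip W R (fun i => (s k).v i - n * π i) := by
    have h2 := gossip_sub (W := W) R (s k).v fun i => (n : ℝ) * π i
    rw [gossip_equilibrium h.equilibrium, ← hs.v_succ] at h2
    exact h2.symm
  rw [h1]
  exact h.contract_real _ (h.sum_deviation hs k)

/-- Keeping the term `- n ^ 2` lets Pythagoras return exactly `n * P` as the bound on `v` at every
iteration, without a loss of constant. -/
theorem deviation_le (h : GossipBounds W π R ρ P) (hs : IsPushDIGing W R γ x0 s) (k : ℕ) :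
    piSq π (fun i => (s k).v i - n * π i) ≤ n * P - n ^ 2 := by
  induction k with
  | zero =>
    have h1 := h.piSq_eq_add (hs.sum_v h.mixing 0)
    have h2 : piSq π (s 0).v ≤ n * P := by
      refine (piSq_le_of_inv_le h.inv_le _).trans_eq ?_
      simp [hs.v_zero, mul_comm]
    linarith
  | succ k ih =>
    refine (h.deviation_succ hs k).trans (le_trans ?_ ih)
    refine mul_le_of_le_one_left (piSq_nonneg h.equilibrium.pos _) ?_
    have := h.le_one
    nlinarith [h.nonneg]

theorem piSq_v_le (h : GossipBounds W π R ρ P) (hs : IsPushDIGing W R γ x0 s) (k : ℕ) :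
    piSq π (s k).v ≤ n * P := by
  have h1 := h.piSq_eq_add (hs.sum_v h.mixing k)
  have h2 := h.deviation_le hs k
  linarith

/-- At least one block of gossip is needed, hence the index `k + 1`: the initial weights `1` may be
far from `n π`, and one factor `ρ` brings them within `n π_i / 7`. -/
theorem le_v (h : GossipBounds W π R ρ P) (hs : IsPushDIGing W R γ x0 s) (k : ℕ) (i : Fin n) :
    6 / 7 * (n * π i) ≤ (s (k + 1)).v i := by
  have hπ := h.equilibrium.pos i
  have hn : (1 : ℝ) ≤ n := by exact_mod_cast h.card_pos
  have hP : 0 < P := by linarith [h.card_le]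
  have h1 : ((s (k + 1)).v i - n * π i) ^ 2 / π i ≤ ρ ^ 2 * (n * P) := by
    calc ((s (k + 1)).v i - n * π i) ^ 2 / π i
        ≤ piSq π (fun i => (s (k + 1)).v i - n * π i) := by
          rw [← sq_abs, ← Real.norm_eq_abs]
          exact Finset.single_le_sum
            (f := fun i => ‖(s (k + 1)).v i - n * π i‖ ^ 2 / π i)
            (fun j _ => div_nonneg (sq_nonneg _) (h.equilibrium.pos j).le) (Finset.mem_univ i)
      _ ≤ ρ ^ 2 * (n * P) := by
          refine (h.deviation_succ hs k).trans ?_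
          have := h.deviation_le hs k
          gcongr
          nlinarith
  have h2 : 1 ≤ P * π i := by
    have := h.inv_le i
    rwa [inv_le_iff_one_le_mul₀ hπ] at this
  have h3 : ((s (k + 1)).v i - n * π i) ^ 2 ≤ (n * π i / 7) ^ 2 := by
    rw [div_le_iff₀ hπ] at h1
    calc _ ≤ ρ ^ 2 * (n * P) * π i := h1
      -- The inserted factor is at least `1` and completes the product to the square of `ρ * P * n`.
      _ ≤ ρ ^ 2 * (n * P) * π i * (P * π i * (n ^ 3)) :=
          le_mul_of_one_le_right (by positivity)
            (one_le_mul_of_one_le_of_one_le h2 (one_le_pow₀ hn))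
      _ = (ρ * P * n) ^ 2 * (n * π i) ^ 2 := by ring
      _ ≤ (1 / 7) ^ 2 * (n * π i) ^ 2 := by
          have := h.small
          have := h.nonneg
          gcongr
      _ = _ := by ring
  have h4 := abs_le_of_sq_le_sq h3 (by positivity)
  linarith [(abs_le.1 h4).1]

theorem consensusSq_le (h : GossipBounds W π R ρ P) (hs : IsPushDIGing W R γ x0 s) (k : ℕ) :
    (s k).consensusSq ≤ 2 * P / n ^ 2 * piSq π (s k).disagreement := by
  have hn : (1 : ℝ) ≤ n := by exact_mod_cast h.card_pos
  have hP : 0 < P := by linarith [h.card_le]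
  -- At the start the lower bound on the weights is not available, but all models coincide and the
  -- consensus error is zero.
  cases k with
  | zero =>
    have : (s 0).consensusSq = 0 := by
      simp [State.consensusSq, hs.w_zero, hs.avg_zero h.card_pos]
    rw [this]
    exact mul_nonneg (by positivity) (piSq_nonneg h.equilibrium.pos _)
  | succ k =>
    rw [State.consensusSq, piSq, Finset.mul_sum]
    refine Finset.sum_le_sum fun i _ => ?_
    have hπ := h.equilibrium.pos i
    have hv := h.le_v hs k i
    have hv0 : 0 < (s (k + 1)).v i := lt_of_lt_of_le (by positivity) hv
    have h1 : (s (k + 1)).w i - (s (k + 1)).avg =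
        ((s (k + 1)).v i)⁻¹ • (s (k + 1)).disagreement i := by
      simp only [hs.w_succ, State.disagreement, Pi.sub_apply, smul_sub, smul_smul]
      rw [inv_mul_cancel₀ hv0.ne', one_smul]
    rw [h1, norm_smul, mul_pow, norm_inv, Real.norm_of_nonneg hv0.le]
    have h2 : ((s (k + 1)).v i)⁻¹ ^ 2 ≤ 2 * P / n ^ 2 / π i := by
      have h3 : 1 ≤ P * π i := by
        have := h.inv_le i
        rwa [inv_le_iff_one_le_mul₀ hπ] at this
      calc ((s (k + 1)).v i)⁻¹ ^ 2 ≤ (6 / 7 * (n * π i))⁻¹ ^ 2 := by gcongr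
        _ = 49 / 36 / (n ^ 2 * π i ^ 2) := by field_simp; norm_num
        _ ≤ 2 * (P * π i) / (n ^ 2 * π i ^ 2) := by gcongr; linarith
        _ = _ := by field_simp
    calc _ ≤ 2 * P / n ^ 2 / π i * ‖(s (k + 1)).disagreement i‖ ^ 2 := by gcongr
      _ = _ := by ring

theorem disagreement_succ_le (h : GossipBounds W π R ρ P) (hs : IsPushDIGing W R γ x0 s) (k : ℕ) :
    piSq π (s (k + 1)).disagreement ≤ 2 * ρ ^ 2 *
      (piSq π (s k).disagreement + γ ^ 2 * piSq π (s k).trackDisagreement) := by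
  rw [hs.disagreement_succ h.mixing]
  refine (h.contract_vec d _ ?_).trans ?_
  · simp only [Pi.sub_apply, Pi.smul_apply, Finset.sum_sub_distrib, ← Finset.smul_sum,
      hs.sum_disagreement h.mixing h.card_pos, hs.sum_trackDisagreement h.mixing h.card_pos]
    simp
  · have h1 := piSq_sub_le h.equilibrium.pos (s k).disagreement (γ • (s k).trackDisagreement)
    have h2 : piSq π (γ • (s k).trackDisagreement) = γ ^ 2 * piSq π (s k).trackDisagreement := by
      simp only [piSq, Pi.smul_apply, norm_smul, mul_pow, Real.norm_eq_abs, sq_abs,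
        Finset.mul_sum, mul_div_assoc]
    rw [h2] at h1
    calc _ ≤ ρ ^ 2 * _ := mul_le_mul_of_nonneg_left h1 (sq_nonneg ρ)
      _ = _ := by ring

theorem trackDisagreement_succ_le (h : GossipBounds W π R ρ P) (hs : IsPushDIGing W R γ x0 s)
    (k : ℕ) : piSq π (s (k + 1)).trackDisagreement ≤ 2 * ρ ^ 2 *
      (piSq π (s k).trackDisagreement + 4 * P * ∑ i, ‖(s k).g i - (s (k + 1)).g i‖ ^ 2) := by
  have hn' : (n : ℝ) ≠ 0 := by have := h.card_pos; positivity
  rw [hs.trackDisagreement_succ]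
  refine (h.contract_vec d _ ?_).trans ?_
  · simp only [Pi.sub_apply, Finset.sum_sub_distrib, ← Finset.sum_smul,
      hs.sum_trackDisagreement h.mixing h.card_pos, hs.sum_v h.mixing]
    rw [smul_smul, mul_inv_cancel₀ hn', one_smul]
    simp
  · have h1 := piSq_sub_le h.equilibrium.pos (s k).trackDisagreement
      (((s k).g - (s (k + 1)).g) -
        fun i => (s k).v i • ((n : ℝ)⁻¹ • ∑ j, ((s k).g - (s (k + 1)).g) j))
    have h2 := piSq_sub_smul_avg_le h.card_pos h.equilibrium.pos h.inv_le (h.piSq_v_le hs k)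
      ((s k).g - (s (k + 1)).g)
    simp only [Pi.sub_apply] at h1 h2 ⊢
    calc _ ≤ ρ ^ 2 * (2 * (piSq π (s k).trackDisagreement +
          4 * P * ∑ i, ‖(s k).g i - (s (k + 1)).g i‖ ^ 2)) := by
          refine mul_le_mul_of_nonneg_left (h1.trans ?_) (sq_nonneg ρ)
          linarith
      _ = _ := by ring

theorem trackDisagreement_zero_le (h : GossipBounds W π R ρ P) (hs : IsPushDIGing W R γ x0 s) :
    piSq π (s 0).trackDisagreement ≤ 4 * P * ∑ i, ‖(s 0).g i‖ ^ 2 := by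
  rw [State.trackDisagreement, hs.y_zero]
  exact piSq_sub_smul_avg_le h.card_pos h.equilibrium.pos h.inv_le (h.piSq_v_le hs 0) (s 0).g

end GossipBounds

end Iteration

end PushDIGing

namespace PushDIGing

section Realization

/-! ### The convergence estimate along one realization of the samples -/

variable {n d : ℕ} {W : Matrix (Fin n) (Fin n) ℝ} {R : ℕ} {γ : ℝ} {x0 : Vec d}
  {s : ℕ → State n d} {f : Fin n → Vec d → ℝ} {L Δ : ℝ} {π : Fin n → ℝ} {ρ P : ℝ}

/-- The errors of the local stochastic gradients. -/
noncomputable def State.noise (s : State n d) (f : Fin n → Vec d → ℝ) (i : Fin n) : Vec d :=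
  s.g i - gradient (f i) (s.w i)

/-- The network average of the errors of the local stochastic gradients. -/
noncomputable def State.avgNoise (s : State n d) (f : Fin n → Vec d → ℝ) : Vec d :=
  (n : ℝ)⁻¹ • ∑ i, s.noise f i

/-- The network average of the exact gradients at the corrected models. -/
noncomputable def State.meanGrad (s : State n d) (f : Fin n → Vec d → ℝ) : Vec d :=
  (n : ℝ)⁻¹ • ∑ i, gradient (f i) (s.w i)

theorem State.avgGrad_eq (s : State n d) (f : Fin n → Vec d → ℝ) :
    s.avgGrad = s.meanGrad f + s.avgNoise f := by
  simp only [State.avgGrad, State.meanGrad, State.avgNoise, State.noise, Finset.sum_sub_distrib]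
  module

theorem norm_add_sq_le_two {E : Type*} [SeminormedAddCommGroup E] (a b : E) :
    ‖a + b‖ ^ 2 ≤ 2 * ‖a‖ ^ 2 + 2 * ‖b‖ ^ 2 := by
  have h := pow_le_pow_left₀ (norm_nonneg _) (norm_add_le a b) 2
  nlinarith [sq_nonneg (‖a‖ - ‖b‖)]

theorem norm_sub_add_sq_le_three {E : Type*} [SeminormedAddCommGroup E] (a b c : E) :
    ‖a - b + c‖ ^ 2 ≤ 3 * (‖a‖ ^ 2 + ‖b‖ ^ 2 + ‖c‖ ^ 2) := by
  have h := pow_le_pow_left₀ (norm_nonneg _)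
    ((norm_add_le (a - b) c).trans (add_le_add_left (norm_sub_le a b) _)) 2
  nlinarith [sq_nonneg (‖a‖ - ‖b‖), sq_nonneg (‖a‖ - ‖c‖), sq_nonneg (‖b‖ - ‖c‖)]

/-- A gradient difference splits into two noises and a difference of exact gradients. Lipschitz
continuity reduces the latter to the motion of `w_i`, which is made of two consensus errors and the
step `γ ḡ`. Each splitting into three terms costs a factor `3`. -/
theorem IsPushDIGing.sum_norm_sub_gradient_le (hs : IsPushDIGing W R γ x0 s)
    (hW : IsMixingMatrix W) (hf : IsSmoothProblem f x0 L Δ) (k : ℕ) :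
    ∑ i, ‖(s k).g i - (s (k + 1)).g i‖ ^ 2 ≤
      3 * ∑ i, ‖(s k).noise f i‖ ^ 2 + 3 * ∑ i, ‖(s (k + 1)).noise f i‖ ^ 2 +
        9 * L ^ 2 * ((s k).consensusSq + (s (k + 1)).consensusSq +
          n * γ ^ 2 * ‖(s k).avgGrad‖ ^ 2) := by
  have h1 : ∀ i, ‖(s k).g i - (s (k + 1)).g i‖ ^ 2 ≤ 3 * (‖(s k).noise f i‖ ^ 2 +
      ‖(s (k + 1)).noise f i‖ ^ 2 + L ^ 2 * (3 * (‖(s k).w i - (s k).avg‖ ^ 2 +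
        ‖(s (k + 1)).w i - (s (k + 1)).avg‖ ^ 2 + γ ^ 2 * ‖(s k).avgGrad‖ ^ 2))) := fun i => by
    have h2 : (s k).g i - (s (k + 1)).g i = (s k).noise f i - (s (k + 1)).noise f i +
        (gradient (f i) ((s k).w i) - gradient (f i) ((s (k + 1)).w i)) := by
      simp only [State.noise]
      abel
    have h3 : (s k).w i - (s (k + 1)).w i = ((s k).w i - (s k).avg) -
        ((s (k + 1)).w i - (s (k + 1)).avg) + γ • (s k).avgGrad := by
      rw [hs.avg_succ hW]
      abel
    rw [h2]
    refine (norm_sub_add_sq_le_three _ _ _).trans ?_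
    gcongr
    calc _ ≤ (L * ‖(s k).w i - (s (k + 1)).w i‖) ^ 2 := by
          gcongr
          exact hf.lipschitz i _ _
      _ = L ^ 2 * ‖(s k).w i - (s (k + 1)).w i‖ ^ 2 := by ring
      _ ≤ _ := by
          have h4 := norm_sub_add_sq_le_three ((s k).w i - (s k).avg)
            ((s (k + 1)).w i - (s (k + 1)).avg) (γ • (s k).avgGrad)
          rw [← h3, norm_smul, mul_pow, Real.norm_eq_abs, sq_abs] at h4
          gcongr
  refine (Finset.sum_le_sum fun i _ => h1 i).trans_eq ?_
  simp only [← Finset.mul_sum, Finset.sum_add_distrib, Finset.sum_const, Finset.card_univ,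
    Fintype.card_fin, nsmul_eq_mul, State.consensusSq]
  ring

/-- Polarization of the inner product of `∇f(x̄)` and `meanGrad` produces both the squared gradient
to be bounded and the useful term `-γ / 2 * ‖meanGrad‖ ^ 2`; their difference is a consensus error.
-/
theorem IsPushDIGing.descent (hs : IsPushDIGing W R γ x0 s) (hW : IsMixingMatrix W) (hn : 1 ≤ n)
    (hf : IsSmoothProblem f x0 L Δ) (hL : 0 ≤ L) (hγ : 0 ≤ γ) (k : ℕ) :
    γ / 2 * ‖gradient (globalObj f) (s k).avg‖ ^ 2 ≤
      globalObj f (s k).avg - globalObj f (s (k + 1)).avg - γ / 2 * ‖(s k).meanGrad f‖ ^ 2 +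
        γ * L ^ 2 / (2 * n) * (s k).consensusSq + L * γ ^ 2 * ‖(s k).avgGrad‖ ^ 2 -
        γ * inner ℝ (gradient (globalObj f) (s k).avg) ((s k).avgNoise f) := by
  have hn' : (0 : ℝ) < n := by exact_mod_cast hn
  have h1 := hf.descent hn hL (s k).avg (-(γ • (s k).avgGrad))
  rw [← sub_eq_add_neg, ← hs.avg_succ hW, inner_neg_right, inner_smul_right, norm_neg, norm_smul,
    mul_pow, Real.norm_eq_abs, sq_abs] at h1
  nth_rw 1 [(s k).avgGrad_eq f] at h1
  rw [inner_add_right] at h1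
  have h2 := norm_sub_sq_real (gradient (globalObj f) (s k).avg) ((s k).meanGrad f)
  have h3 : n * ‖gradient (globalObj f) (s k).avg - (s k).meanGrad f‖ ^ 2 ≤
      L ^ 2 * (s k).consensusSq := by
    rw [gradient_globalObj hf.differentiable, State.meanGrad, ← smul_sub,
      ← Finset.sum_sub_distrib]
    refine (norm_avg_sq_le hn _).trans ?_
    rw [State.consensusSq, Finset.mul_sum]
    refine Finset.sum_le_sum fun i _ => ?_
    rw [← mul_pow, norm_sub_rev ((s k).w i)]
    exact pow_le_pow_left₀ (norm_nonneg _) (hf.lipschitz i _ _) 2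
  have h4 : ‖gradient (globalObj f) (s k).avg - (s k).meanGrad f‖ ^ 2 ≤
      L ^ 2 * (s k).consensusSq / n := by
    rw [le_div_iff₀ hn']
    linarith
  have h5 : γ * L ^ 2 / (2 * n) * (s k).consensusSq =
      γ / 2 * (L ^ 2 * (s k).consensusSq / n) := by
    field_simp
  rw [h5]
  have h6 := mul_le_mul_of_nonneg_left h4 (by positivity : 0 ≤ γ / 2)
  rw [h2] at h6
  linarith

theorem sum_range_succ_le_of_succ_le {a b : ℕ → ℝ} (h : ∀ k, a (k + 1) ≤ b k) (K : ℕ) :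
    ∑ k ∈ Finset.range (K + 1), a k ≤ a 0 + ∑ k ∈ Finset.range K, b k := by
  rw [Finset.sum_range_succ', add_comm]
  gcongr
  exact h _

theorem sum_range_le_sum_range_succ {a : ℕ → ℝ} (h : ∀ k, 0 ≤ a k) (K : ℕ) :
    ∑ k ∈ Finset.range K, a k ≤ ∑ k ∈ Finset.range (K + 1), a k := by
  rw [Finset.sum_range_succ]
  linarith [h K]

theorem sum_range_shift_le_sum_range_succ {a : ℕ → ℝ} (h : ∀ k, 0 ≤ a k) (K : ℕ) :
    ∑ k ∈ Finset.range K, a (k + 1) ≤ ∑ k ∈ Finset.range (K + 1), a k := by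
  rw [Finset.sum_range_succ']
  linarith [h 0]

/-- Solving the coupled recursions of the consensus error `E`, the disagreements `Z` and `U` of the
models and of the trackers, and the gradient differences `D`, all summed over the iterations. -/
theorem consensus_bound_of_recursion {n ρ P γ L E Z U D S Q G0 : ℝ} (hn : 1 ≤ n) (hP : 1 ≤ P)
    (hρ : 0 ≤ ρ) (hsmall : ρ * P * n ≤ 1 / 7) (hL : 0 ≤ L) (hγ : 0 ≤ γ) (hγL : γ * L ≤ 1 / 6)
    (hE0 : 0 ≤ E) (hZ0 : 0 ≤ Z) (hU0 : 0 ≤ U) (hG00 : 0 ≤ G0) (hD0 : 0 ≤ D)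
    (h1 : E ≤ 2 * P / n ^ 2 * Z) (h2 : Z ≤ 2 * ρ ^ 2 * (Z + γ ^ 2 * U))
    (h3 : U ≤ 4 * P * G0 + 2 * ρ ^ 2 * (U + 4 * P * D))
    (h4 : D ≤ 6 * S + 18 * L ^ 2 * E + 9 * n * L ^ 2 * γ ^ 2 * Q) :
    E ≤ 4 * γ ^ 2 / n ^ 4 * G0 +
      2 * γ ^ 2 / n ^ 2 * (6 * S + 9 * n * L ^ 2 * γ ^ 2 * Q) := by
  have hn0 : 0 < n := by linarith
  have hρ7 : ρ ≤ 1 / 7 := by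
    refine le_trans ?_ hsmall
    rw [mul_assoc]
    exact le_mul_of_one_le_right hρ (one_le_mul_of_one_le_of_one_le hP hn)
  have hρ1 : ρ ^ 2 ≤ 1 / 49 := by nlinarith
  -- Since `2 ρ² ≤ 2 / 49`, the terms in `U`, and below those in `Z`, move to the left-hand side at
  -- the cost of at most a factor `2`.
  have h5 : U ≤ 8 * P * G0 + 16 * (ρ ^ 2 * (P * D)) := by
    have := mul_le_mul_of_nonneg_right hρ1 hU0
    nlinarith
  have h6 : Z ≤ 4 * ρ ^ 2 * (γ ^ 2 * U) := by
    have := mul_le_mul_of_nonneg_right hρ1 hZ0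
    nlinarith
  have hρn : ρ * P ≤ 1 / 7 / n := by
    rw [le_div_iff₀ hn0]
    exact hsmall
  have hsq : (ρ * P) ^ 2 ≤ 1 / n ^ 2 / 49 := by
    calc (ρ * P) ^ 2 ≤ (1 / 7 / n) ^ 2 := by gcongr
      _ = _ := by field_simp; norm_num
  -- Both powers of `P` pair with powers of `ρ`. The gain `1 / n ^ 2` in `(ρ * P) ^ 2` is kept for
  -- the initial gradients and discarded in front of `D`, where a second `ρ ^ 2` is at hand.
  have h7 : E ≤ 2 * γ ^ 2 / n ^ 4 * G0 + γ ^ 2 / n ^ 2 * D := by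
    have hsq' : (ρ * P) ^ 2 ≤ 1 / 49 := by
      refine hsq.trans ?_
      have : 1 / n ^ 2 ≤ 1 := by
        rw [div_le_one (by positivity)]
        exact one_le_pow₀ hn
      linarith
    calc E ≤ 2 * P / n ^ 2 * (4 * ρ ^ 2 * (γ ^ 2 * (8 * P * G0 + 16 * (ρ ^ 2 * (P * D))))) := by
          refine h1.trans ?_
          gcongr
          refine h6.trans ?_
          gcongr
      _ = 64 * γ ^ 2 / n ^ 2 * G0 * (ρ * P) ^ 2 +
          128 * γ ^ 2 / n ^ 2 * D * ((ρ * P) ^ 2 * ρ ^ 2) := by ring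
      _ ≤ 64 * γ ^ 2 / n ^ 2 * G0 * (1 / n ^ 2 / 49) +
          128 * γ ^ 2 / n ^ 2 * D * (1 / 49 * (1 / 49)) := by gcongr
      _ = 64 / 49 * (γ ^ 2 / n ^ 4 * G0) + 128 / 2401 * (γ ^ 2 / n ^ 2 * D) := by
          field_simp
          ring
      _ ≤ 2 * (γ ^ 2 / n ^ 4 * G0) + 1 * (γ ^ 2 / n ^ 2 * D) := by gcongr <;> norm_num
      _ = _ := by ring
  -- This closes the loop: the feedback of `E` through the gradient differences is at most half of
  -- `E`, because `18 / 6 ^ 2 = 1 / 2`.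
  have h8 : γ ^ 2 / n ^ 2 * (18 * L ^ 2 * E) ≤ E / 2 := by
    have : (γ * L) ^ 2 ≤ (1 / 6) ^ 2 := by gcongr
    calc γ ^ 2 / n ^ 2 * (18 * L ^ 2 * E) = 18 * E * ((γ * L) ^ 2 / n ^ 2) := by ring
      _ ≤ 18 * E * ((1 / 6) ^ 2 / 1 ^ 2) := by gcongr
      _ = E / 2 := by ring
  have h9 : γ ^ 2 / n ^ 2 * D ≤
      γ ^ 2 / n ^ 2 * (6 * S + 18 * L ^ 2 * E + 9 * n * L ^ 2 * γ ^ 2 * Q) := by gcongr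
  have h10 : γ ^ 2 / n ^ 2 * (6 * S + 18 * L ^ 2 * E + 9 * n * L ^ 2 * γ ^ 2 * Q) =
      γ ^ 2 / n ^ 2 * (18 * L ^ 2 * E) +
        γ ^ 2 / n ^ 2 * (6 * S + 9 * n * L ^ 2 * γ ^ 2 * Q) := by ring
  have h11 : 4 * γ ^ 2 / n ^ 4 * G0 + 2 * γ ^ 2 / n ^ 2 * (6 * S + 9 * n * L ^ 2 * γ ^ 2 * Q) =
      2 * (2 * γ ^ 2 / n ^ 4 * G0 +
        γ ^ 2 / n ^ 2 * (6 * S + 9 * n * L ^ 2 * γ ^ 2 * Q)) := by ring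
  rw [h11]
  linarith

theorem GossipBounds.sum_consensusSq_le (h : GossipBounds W π R ρ P)
    (hs : IsPushDIGing W R γ x0 s) (hf : IsSmoothProblem f x0 L Δ) (hL : 0 ≤ L) (hγ : 0 ≤ γ)
    (hγL : γ * L ≤ 1 / 6) (K : ℕ) :
    ∑ k ∈ Finset.range (K + 1), (s k).consensusSq ≤
      4 * γ ^ 2 / n ^ 4 * ∑ i, ‖(s 0).g i‖ ^ 2 + 2 * γ ^ 2 / n ^ 2 *
        (6 * ∑ k ∈ Finset.range (K + 1), ∑ i, ‖(s k).noise f i‖ ^ 2 +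
          9 * n * L ^ 2 * γ ^ 2 * ∑ k ∈ Finset.range (K + 1), ‖(s k).avgGrad‖ ^ 2) := by
  have hn : (1 : ℝ) ≤ n := by exact_mod_cast h.card_pos
  have hn0 : (0 : ℝ) < n := by linarith
  have hP : 1 ≤ P := hn.trans h.card_le
  have hρ := h.nonneg
  have hpos := h.equilibrium.pos
  set E := ∑ k ∈ Finset.range (K + 1), (s k).consensusSq with hE
  set S := ∑ k ∈ Finset.range (K + 1), ∑ i, ‖(s k).noise f i‖ ^ 2 with hS
  set Q := ∑ k ∈ Finset.range (K + 1), ‖(s k).avgGrad‖ ^ 2 with hQ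
  set G0 := ∑ i, ‖(s 0).g i‖ ^ 2 with hG0
  set Z := ∑ k ∈ Finset.range (K + 1), piSq π (s k).disagreement with hZ
  set U := ∑ k ∈ Finset.range (K + 1), piSq π (s k).trackDisagreement with hU
  set D := ∑ k ∈ Finset.range K, ∑ i, ‖(s k).g i - (s (k + 1)).g i‖ ^ 2 with hD
  have he0 : ∀ k, 0 ≤ (s k).consensusSq := fun k => Finset.sum_nonneg fun i _ => sq_nonneg _
  have hS0 : ∀ k, 0 ≤ ∑ i, ‖(s k).noise f i‖ ^ 2 := fun k =>
    Finset.sum_nonneg fun i _ => sq_nonneg _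
  have hZ0 : 0 ≤ Z := Finset.sum_nonneg fun k _ => piSq_nonneg hpos _
  have hU0 : 0 ≤ U := Finset.sum_nonneg fun k _ => piSq_nonneg hpos _
  have hE0 : 0 ≤ E := Finset.sum_nonneg fun k _ => he0 k
  have hG00 : 0 ≤ G0 := Finset.sum_nonneg fun k _ => sq_nonneg _
  have hD0 : 0 ≤ D := Finset.sum_nonneg fun k _ => Finset.sum_nonneg fun i _ => sq_nonneg _
  have h1 : E ≤ 2 * P / n ^ 2 * Z := by
    rw [hE, hZ, Finset.mul_sum]
    exact Finset.sum_le_sum fun k _ => h.consensusSq_le hs k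
  have h2 : Z ≤ 2 * ρ ^ 2 * (Z + γ ^ 2 * U) := by
    have h3 := sum_range_succ_le_of_succ_le (a := fun k => piSq π (s k).disagreement)
      (fun k => h.disagreement_succ_le hs k) K
    rw [hs.disagreement_zero h.card_pos] at h3
    have h4 := sum_range_le_sum_range_succ
      (fun k => piSq_nonneg hpos (s k).disagreement) K
    have h5 := sum_range_le_sum_range_succ
      (fun k => piSq_nonneg hpos (s k).trackDisagreement) K
    simp only [← Finset.mul_sum, Finset.sum_add_distrib] at h3
    have h6 : piSq π (0 : Fin n → Vec d) = 0 := by simp [piSq]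
    rw [h6, zero_add] at h3
    refine h3.trans ?_
    gcongr
  have h3 : U ≤ 4 * P * G0 + 2 * ρ ^ 2 * (U + 4 * P * D) := by
    have h3 := sum_range_succ_le_of_succ_le (a := fun k => piSq π (s k).trackDisagreement)
      (fun k => h.trackDisagreement_succ_le hs k) K
    have h5 := sum_range_le_sum_range_succ
      (fun k => piSq_nonneg hpos (s k).trackDisagreement) K
    simp only [← Finset.mul_sum, Finset.sum_add_distrib] at h3
    refine h3.trans ?_
    gcongr
    exact h.trackDisagreement_zero_le hs
  have h4 : D ≤ 6 * S + 18 * L ^ 2 * E + 9 * n * L ^ 2 * γ ^ 2 * Q := by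
    have h3 := Finset.sum_le_sum fun k (_ : k ∈ Finset.range K) =>
      hs.sum_norm_sub_gradient_le h.mixing hf k
    simp only [← Finset.mul_sum, Finset.sum_add_distrib] at h3
    have a1 := sum_range_le_sum_range_succ hS0 K
    have a2 := sum_range_shift_le_sum_range_succ hS0 K
    have a3 := sum_range_le_sum_range_succ he0 K
    have a4 := sum_range_shift_le_sum_range_succ he0 K
    have a5 := sum_range_le_sum_range_succ (fun k => sq_nonneg ‖(s k).avgGrad‖) K
    refine h3.trans ?_
    calc _ ≤ 3 * S + 3 * S + 9 * L ^ 2 * (E + E + n * γ ^ 2 * Q) := by gcongr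
      _ = _ := by ring
  exact consensus_bound_of_recursion hn hP hρ h.small hL hγ hγL hE0 hZ0 hU0 hG00 hD0 h1 h2 h3 h4

theorem GossipBounds.sum_norm_gradient_sq_le (h : GossipBounds W π R ρ P)
    (hs : IsPushDIGing W R γ x0 s) (hf : IsSmoothProblem f x0 L Δ) (hL : 0 ≤ L) (hγ : 0 < γ)
    (hγL : γ * L ≤ 1 / 6) (K : ℕ) :
    ∑ k ∈ Finset.range (K + 1), ‖gradient (globalObj f) (s k).avg‖ ^ 2 ≤
      2 * Δ / γ + 4 * γ ^ 2 * L ^ 2 / n ^ 5 * ∑ i, ‖(s 0).g i‖ ^ 2 +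
        12 * γ ^ 2 * L ^ 2 / n ^ 3 *
          ∑ k ∈ Finset.range (K + 1), ∑ i, ‖(s k).noise f i‖ ^ 2 +
        6 * L * γ * ∑ k ∈ Finset.range (K + 1), ‖(s k).avgNoise f‖ ^ 2 -
        2 * ∑ k ∈ Finset.range (K + 1),
          inner ℝ (gradient (globalObj f) (s k).avg) ((s k).avgNoise f) := by
  have hn : (1 : ℝ) ≤ n := by exact_mod_cast h.card_pos
  have hn0 : (0 : ℝ) < n := by linarith
  have h1 := Finset.sum_le_sum fun k (_ : k ∈ Finset.range (K + 1)) =>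
    hs.descent h.mixing h.card_pos hf hL hγ.le k
  simp only [Finset.sum_sub_distrib, Finset.sum_add_distrib, ← Finset.mul_sum] at h1
  rw [← Finset.sum_sub_distrib,
    Finset.sum_range_sub' fun k => globalObj f (s k).avg] at h1
  have h2 : globalObj f (s 0).avg - globalObj f (s (K + 1)).avg ≤ Δ := by
    have h3 := ciInf_le hf.bddBelow (s (K + 1)).avg
    have h4 := hf.gap
    rw [hs.avg_zero h.card_pos]
    linarith
  have h3 := h.sum_consensusSq_le hs hf hL hγ.le hγL K
  have h4 := Finset.sum_le_sum fun k (_ : k ∈ Finset.range (K + 1)) =>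
    norm_add_sq_le_two ((s k).meanGrad f) ((s k).avgNoise f)
  simp only [← State.avgGrad_eq, Finset.sum_add_distrib, ← Finset.mul_sum] at h4
  set A := ∑ k ∈ Finset.range (K + 1), ‖gradient (globalObj f) (s k).avg‖ ^ 2
  set E := ∑ k ∈ Finset.range (K + 1), (s k).consensusSq
  set S := ∑ k ∈ Finset.range (K + 1), ∑ i, ‖(s k).noise f i‖ ^ 2
  set Q := ∑ k ∈ Finset.range (K + 1), ‖(s k).avgGrad‖ ^ 2
  set H := ∑ k ∈ Finset.range (K + 1), ‖(s k).meanGrad f‖ ^ 2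
  set B := ∑ k ∈ Finset.range (K + 1), ‖(s k).avgNoise f‖ ^ 2
  set I := ∑ k ∈ Finset.range (K + 1),
    inner ℝ (gradient (globalObj f) (s k).avg) ((s k).avgNoise f)
  set G0 := ∑ i, ‖(s 0).g i‖ ^ 2
  have hH0 : 0 ≤ H := Finset.sum_nonneg fun k _ => sq_nonneg _
  have hB0 : 0 ≤ B := Finset.sum_nonneg fun k _ => sq_nonneg _
  have hQ0 : 0 ≤ Q := Finset.sum_nonneg fun k _ => sq_nonneg _
  have hγL0 : 0 ≤ γ * L := by positivity
  have h5 : γ * L ^ 2 / (2 * n) * E ≤ γ * (2 * γ ^ 2 * L ^ 2 / n ^ 5 * G0 +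
      6 * γ ^ 2 * L ^ 2 / n ^ 3 * S + 1 / 24 * (γ * L) * Q) := by
    calc γ * L ^ 2 / (2 * n) * E ≤ γ * L ^ 2 / (2 * n) * (4 * γ ^ 2 / n ^ 4 * G0 +
          2 * γ ^ 2 / n ^ 2 * (6 * S + 9 * n * L ^ 2 * γ ^ 2 * Q)) := by gcongr
      _ = γ * (2 * γ ^ 2 * L ^ 2 / n ^ 5 * G0 + 6 * γ ^ 2 * L ^ 2 / n ^ 3 * S +
          9 * ((γ * L) ^ 3 / n ^ 2) * (γ * L) * Q) := by field_simp; ring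
      _ ≤ γ * (2 * γ ^ 2 * L ^ 2 / n ^ 5 * G0 + 6 * γ ^ 2 * L ^ 2 / n ^ 3 * S +
          9 * ((1 / 6) ^ 3 / 1 ^ 2) * (γ * L) * Q) := by gcongr
      _ = _ := by ring
  have h6 : A ≤ 2 / γ * (Δ - γ / 2 * H + γ * (2 * γ ^ 2 * L ^ 2 / n ^ 5 * G0 +
      6 * γ ^ 2 * L ^ 2 / n ^ 3 * S + 1 / 24 * (γ * L) * Q) + L * γ ^ 2 * Q - γ * I) := by
    rw [div_mul_eq_mul_div, le_div_iff₀ hγ]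
    linarith
  have h7 : 2 / γ * (Δ - γ / 2 * H + γ * (2 * γ ^ 2 * L ^ 2 / n ^ 5 * G0 +
      6 * γ ^ 2 * L ^ 2 / n ^ 3 * S + 1 / 24 * (γ * L) * Q) + L * γ ^ 2 * Q - γ * I) =
      2 * Δ / γ + 4 * γ ^ 2 * L ^ 2 / n ^ 5 * G0 + 12 * γ ^ 2 * L ^ 2 / n ^ 3 * S +
        (25 / 12 * (γ * L) * Q - H) - 2 * I := by
    field_simp
    ring
  rw [h7] at h6
  -- The coefficient is `2` from smoothness plus `1 / 12` from consensus. As `Q ≤ 2 H + 2 B` and `γ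
  -- L ≤ 1 / 6`, the share of `H` is at most `25 / 36 < 1` and is absorbed.
  have h8 : 25 / 12 * (γ * L) * Q - H ≤ 6 * L * γ * B := by
    have h9 : γ * L * Q ≤ γ * L * (2 * H + 2 * B) := by gcongr
    have h10 : γ * L * H ≤ 1 / 6 * H := by gcongr
    have h11 : 0 ≤ γ * L * B := by positivity
    nlinarith
  linarith

end Realization

end PushDIGing

namespace PushDIGing

section GossipRounds

/-! ### The number of gossip rounds -/

variable {n : ℕ} {W : Matrix (Fin n) (Fin n) ℝ} {π : Fin n → ℝ}

theorem betaPi_nonneg (W : Matrix (Fin n) (Fin n) ℝ) (π : Fin n → ℝ) : 0 ≤ betaPi W π :=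
  norm_nonneg _

theorem IsEquilibrium.iInf_pos (hn : 1 ≤ n) (hπ : IsEquilibrium W π) : 0 < ⨅ i, π i := by
  have : Nonempty (Fin n) := ⟨⟨0, hn⟩⟩
  obtain ⟨i, hi⟩ := exists_eq_ciInf_of_finite (f := π)
  exact hi ▸ hπ.pos i

theorem IsEquilibrium.one_le_kappaPi (hn : 1 ≤ n) (hπ : IsEquilibrium W π) : 1 ≤ kappaPi π := by
  rw [kappaPi, one_le_div (hπ.iInf_pos hn)]
  exact (ciInf_le (Set.finite_range π).bddBelow ⟨0, hn⟩).trans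
    (le_ciSup (Set.finite_range π).bddAbove ⟨0, hn⟩)

/-- The largest weight is at least the mean `1 / n`, so the smallest is at least `1 / (n κ)`. -/
theorem IsEquilibrium.inv_le (hn : 1 ≤ n) (hπ : IsEquilibrium W π) (i : Fin n) :
    (π i)⁻¹ ≤ n * kappaPi π := by
  have h1 : ⨅ j, π j ≤ π i := ciInf_le (Set.finite_range π).bddBelow i
  have h2 : 1 ≤ n * ⨆ j, π j := by
    calc (1 : ℝ) = ∑ i, π i := hπ.sum_eq_one.symm
      _ ≤ ∑ _i : Fin n, ⨆ j, π j :=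
          Finset.sum_le_sum fun i _ => le_ciSup (Set.finite_range π).bddAbove i
      _ = _ := by simp
  calc (π i)⁻¹ ≤ (⨅ j, π j)⁻¹ := inv_anti₀ (hπ.iInf_pos hn) h1
    _ ≤ (⨅ j, π j)⁻¹ * (n * ⨆ j, π j) :=
        le_mul_of_one_le_right (inv_nonneg.2 (hπ.iInf_pos hn).le) h2
    _ = _ := by rw [kappaPi]; ring

theorem le_gossipRounds {κ β : ℝ} (hn : 1 ≤ n) (hκ : 1 ≤ κ) (hβ : β < 1) :
    2 + 7 * Real.log κ + 2 * Real.log n ≤ (1 - β) * gossipRounds n κ β := by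
  have h1 : 0 ≤ Real.log κ := Real.log_nonneg hκ
  have h2 : 0 ≤ Real.log n := Real.log_nonneg (by exact_mod_cast hn)
  have h3 := Nat.le_ceil
    (((1 + √(7 * Real.log κ)) ^ 2 + (1 + √(2 * Real.log n)) ^ 2) / (1 - β))
  rw [div_le_iff₀ (by linarith)] at h3
  rw [gossipRounds]
  have h4 := Real.sq_sqrt (by positivity : 0 ≤ 7 * Real.log κ)
  have h5 := Real.sq_sqrt (by positivity : 0 ≤ 2 * Real.log n)
  nlinarith [Real.sqrt_nonneg (7 * Real.log κ), Real.sqrt_nonneg (2 * Real.log n)]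

/-- Uses `(1 + √a) ^ 2 ≤ 2 (1 + a)`; the `1` lost to the ceiling is `(1 - β) / (1 - β)`. This bound
turns a rate in `K + 1` into a rate in `T`. -/
theorem gossipRounds_le {κ β : ℝ} (hn : 1 ≤ n) (hκ : 1 ≤ κ) (hβ0 : 0 ≤ β) (hβ : β < 1) :
    (gossipRounds n κ β : ℝ) ≤ 14 * (1 + Real.log κ) * (1 + Real.log n) / (1 - β) := by
  have h1 : 0 ≤ Real.log κ := Real.log_nonneg hκ
  have h2 : 0 ≤ Real.log n := Real.log_nonneg (by exact_mod_cast hn)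
  have h0 : 0 < 1 - β := by linarith
  have h3 := (Nat.ceil_lt_add_one (a := ((1 + √(7 * Real.log κ)) ^ 2 +
    (1 + √(2 * Real.log n)) ^ 2) / (1 - β)) (by positivity)).le
  rw [gossipRounds]
  refine h3.trans ?_
  rw [div_add_one h0.ne']
  gcongr
  have h4 := Real.sq_sqrt (by positivity : 0 ≤ 7 * Real.log κ)
  have h5 := Real.sq_sqrt (by positivity : 0 ≤ 2 * Real.log n)
  nlinarith [sq_nonneg (√(7 * Real.log κ) - 1), sq_nonneg (√(2 * Real.log n) - 1),
    mul_nonneg h1 h2]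

theorem pow_gossipRounds_le {κ β : ℝ} (hn : 1 ≤ n) (hκ : 1 ≤ κ) (hβ0 : 0 ≤ β) (hβ : β < 1) :
    β ^ gossipRounds n κ β * (n * κ) * n ≤ 1 / 7 := by
  have hn0 : (0 : ℝ) < n := by exact_mod_cast hn
  have h1 : 0 ≤ Real.log κ := Real.log_nonneg hκ
  have h2 := le_gossipRounds hn hκ hβ
  set R := gossipRounds n κ β
  have h3 : β ^ R ≤ Real.exp (-2 - Real.log κ - 2 * Real.log n) := by
    calc β ^ R ≤ Real.exp (β - 1) ^ R := by
          gcongr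
          linarith [Real.add_one_le_exp (β - 1)]
      _ = Real.exp (R * (β - 1)) := (Real.exp_nat_mul _ _).symm
      _ ≤ _ := Real.exp_le_exp.2 (by linarith)
  have h4 : κ * n * n = Real.exp (Real.log κ + 2 * Real.log n) := by
    rw [two_mul, ← add_assoc, Real.exp_add, Real.exp_add, Real.exp_log (by linarith),
      Real.exp_log hn0]
  calc β ^ R * (n * κ) * n = β ^ R * (κ * n * n) := by ring
    _ ≤ Real.exp (-2 - Real.log κ - 2 * Real.log n) *
        Real.exp (Real.log κ + 2 * Real.log n) := by
        rw [h4]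
        gcongr
    _ = (Real.exp 1 ^ 2)⁻¹ := by
        rw [← Real.exp_add, ← Real.exp_nat_mul, ← Real.exp_neg]
        congr 1
        push_cast
        ring
    _ ≤ 1 / 7 := by
        rw [one_div]
        refine inv_anti₀ (by norm_num) ?_
        nlinarith [Real.exp_one_gt_d9]

theorem gossipBounds (hn : 1 ≤ n) (hW : IsMixingMatrix W) (hπ : IsEquilibrium W π)
    (hβ : betaPi W π < 1) :
    GossipBounds W π (gossipRounds n (kappaPi π) (betaPi W π))
      (betaPi W π ^ gossipRounds n (kappaPi π) (betaPi W π)) (n * kappaPi π) where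
  mixing := hW
  equilibrium := hπ
  contract_real := piSq_gossip_le hW (piSq_wProtocol_real hπ.pos) _
  contract_vec _ := piSq_gossip_le hW (piSq_wProtocol_vec hπ.pos) _
  inv_le := hπ.inv_le hn
  nonneg := pow_nonneg (betaPi_nonneg W π) _
  small := pow_gossipRounds_le hn (hπ.one_le_kappaPi hn) (betaPi_nonneg W π) hβ
  card_pos := hn
  card_le := le_mul_of_one_le_right (Nat.cast_nonneg n) (hπ.one_le_kappaPi hn)

end GossipRounds

end PushDIGing

namespace PushDIGing

section Fresh

/-! ### Fresh samples -/

variable {Ω Ξ E : Type*} {d : ℕ} [MeasurableSpace Ω] [MeasurableSpace Ξ] [MeasurableSpace E]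
  {μ : Measure Ω}

theorem integrable_inner_of_memLp {a b : Ω → Vec d} (ha : MemLp a 2 μ) (hb : MemLp b 2 μ) :
    Integrable (fun ω => (inner ℝ (a ω) (b ω) : ℝ)) μ := by
  have h1 := (memLp_two_iff_integrable_sq_norm ha.1).1 ha
  have h2 := (memLp_two_iff_integrable_sq_norm hb.1).1 hb
  refine (h1.add h2).mono' (ha.1.inner hb.1) (Filter.Eventually.of_forall fun ω => ?_)
  have h3 := norm_inner_le_norm (𝕜 := ℝ) (a ω) (b ω)
  simp only [Pi.add_apply]
  nlinarith [sq_nonneg (‖a ω‖ - ‖b ω‖), norm_nonneg (a ω), norm_nonneg (b ω)]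

theorem integral_norm_sum_sq_of_orthogonal {ι : Type*} (A : Finset ι) {e : ι → Ω → Vec d}
    (he : ∀ a ∈ A, MemLp (e a) 2 μ)
    (h0 : ∀ a ∈ A, ∀ b ∈ A, a ≠ b → ∫ ω, (inner ℝ (e a ω) (e b ω) : ℝ) ∂μ = 0) :
    ∫ ω, ‖∑ a ∈ A, e a ω‖ ^ 2 ∂μ = ∑ a ∈ A, ∫ ω, ‖e a ω‖ ^ 2 ∂μ := by
  have h1 : ∀ ω, ‖∑ a ∈ A, e a ω‖ ^ 2 = ∑ a ∈ A, ∑ b ∈ A, (inner ℝ (e a ω) (e b ω) : ℝ) :=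
    fun ω => by
      rw [← real_inner_self_eq_norm_sq, sum_inner]
      simp only [inner_sum]
  simp only [h1]
  rw [integral_finsetSum _ fun a ha => integrable_finsetSum _ fun b hb =>
    integrable_inner_of_memLp (he a ha) (he b hb)]
  refine Finset.sum_congr rfl fun a ha => ?_
  rw [integral_finsetSum _ fun b hb => integrable_inner_of_memLp (he a ha) (he b hb),
    Finset.sum_eq_single_of_mem a ha fun b hb hab => h0 a ha b hb hab.symm]
  simp only [real_inner_self_eq_norm_sq]

variable [IsProbabilityMeasure μ] {X : Ω → E} {ξ : Ω → Ξ} {h : E → Ξ → Vec d} {c : ℝ}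

/-- By independence the joint law of `X` and `ξ` is a product, so a bound uniform in the frozen
query point `x` integrates by Fubini. No moment of `X` is required. -/
theorem integrable_fresh (hX : Measurable X) (hξ : Measurable ξ) (hind : IndepFun X ξ μ)
    (hh : Measurable (Function.uncurry h))
    (hint : ∀ x, Integrable (fun s => ‖h x s‖ ^ 2) (μ.map ξ))
    (hc : ∀ x, ∫ s, ‖h x s‖ ^ 2 ∂μ.map ξ ≤ c) :
    Integrable (fun ω => ‖h (X ω) (ξ ω)‖ ^ 2) μ ∧ ∫ ω, ‖h (X ω) (ξ ω)‖ ^ 2 ∂μ ≤ c := by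
  have hprod := (indepFun_iff_map_prod_eq_prod_map_map hX.aemeasurable hξ.aemeasurable).1 hind
  have : IsProbabilityMeasure (μ.map ξ) := Measure.isProbabilityMeasure_map hξ.aemeasurable
  have : IsProbabilityMeasure (μ.map X) := Measure.isProbabilityMeasure_map hX.aemeasurable
  have hsm : StronglyMeasurable fun p : E × Ξ => ‖h p.1 p.2‖ ^ 2 :=
    (hh.norm.pow_const 2).stronglyMeasurable
  have hpair : Measurable fun ω => (X ω, ξ ω) := hX.prodMk hξ
  have hI : Integrable (fun p : E × Ξ => ‖h p.1 p.2‖ ^ 2) ((μ.map X).prod (μ.map ξ)) := by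
    rw [integrable_prod_iff hsm.aestronglyMeasurable]
    refine ⟨Filter.Eventually.of_forall hint, ?_⟩
    refine (integrable_const c).mono' ?_ (Filter.Eventually.of_forall fun x => ?_)
    · exact (StronglyMeasurable.integral_prod_right'
        (f := fun p : E × Ξ => ‖‖h p.1 p.2‖ ^ 2‖) hsm.norm).aestronglyMeasurable
    · simp only [Real.norm_of_nonneg (sq_nonneg ‖_‖)]
      rw [Real.norm_of_nonneg (integral_nonneg fun s => sq_nonneg _)]
      exact hc x
  have hI' := hI
  rw [← hprod] at hI'
  refine ⟨hI'.comp_measurable hpair, ?_⟩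
  have h1 := integral_map (μ := μ) hpair.aemeasurable
    (f := fun p : E × Ξ => ‖h p.1 p.2‖ ^ 2) hsm.aestronglyMeasurable
  rw [← h1, hprod, integral_prod _ hI]
  calc _ ≤ ∫ _, c ∂μ.map X := by
        refine integral_mono hI.integral_prod_left (integrable_const c) hc
    _ = c := by simp

theorem integral_inner_fresh_eq_zero (hX : Measurable X) (hξ : Measurable ξ) (hind : IndepFun X ξ μ)
    {V : E → Vec d} (hV : Measurable V) (hh : Measurable (Function.uncurry h))
    (hint : ∀ x, Integrable (h x) (μ.map ξ)) (h0 : ∀ x, ∫ s, h x s ∂μ.map ξ = 0)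
    (hI : Integrable (fun ω => (inner ℝ (V (X ω)) (h (X ω) (ξ ω)) : ℝ)) μ) :
    ∫ ω, (inner ℝ (V (X ω)) (h (X ω) (ξ ω)) : ℝ) ∂μ = 0 := by
  have hprod := (indepFun_iff_map_prod_eq_prod_map_map hX.aemeasurable hξ.aemeasurable).1 hind
  have : IsProbabilityMeasure (μ.map ξ) := Measure.isProbabilityMeasure_map hξ.aemeasurable
  have : IsProbabilityMeasure (μ.map X) := Measure.isProbabilityMeasure_map hX.aemeasurable
  have hm : Measurable fun p : E × Ξ => (inner ℝ (V p.1) (h p.1 p.2) : ℝ) :=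
    (hV.comp measurable_fst).inner hh
  have hpair : Measurable fun ω => (X ω, ξ ω) := hX.prodMk hξ
  have hI' : Integrable (fun p : E × Ξ => (inner ℝ (V p.1) (h p.1 p.2) : ℝ))
      ((μ.map X).prod (μ.map ξ)) := by
    rw [← hprod, integrable_map_measure hm.aestronglyMeasurable hpair.aemeasurable]
    exact hI
  have h1 := integral_map (μ := μ) hpair.aemeasurable
    (f := fun p : E × Ξ => (inner ℝ (V p.1) (h p.1 p.2) : ℝ)) hm.aestronglyMeasurable
  rw [← h1, hprod, integral_prod _ hI']
  simp only [integral_inner (hint _), h0, inner_zero_right, integral_zero]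

end Fresh

/-! ### Scalings and Lipschitz maps of vector-valued functions -/

section Vec

variable {Ω : Type*} {d : ℕ}

theorem measurable_smul_vec [MeasurableSpace Ω] (c : ℝ) {z : Ω → Vec d} (hz : Measurable z) :
    Measurable fun ω => c • z ω :=
  hz.const_smul c

theorem memLp_smul_vec [MeasurableSpace Ω] {μ : Measure Ω} (c : ℝ) {z : Ω → Vec d} (hz : MemLp z 2 μ) :
    MemLp (fun ω => c • z ω) 2 μ :=
  hz.const_smul c

theorem continuous_of_norm_sub_le {h : Vec d → Vec d} {L : ℝ} (hL : 0 ≤ L)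
    (hh : ∀ x y, ‖h x - h y‖ ≤ L * ‖x - y‖) : Continuous h :=
  (LipschitzWith.of_dist_le_mul (K := ⟨L, hL⟩) fun x y => by
    rw [dist_eq_norm, dist_eq_norm]
    exact hh x y).continuous

end Vec

section Samples

/-! ### The stochastic gradients as functions of the samples -/

variable {Ω Ξ : Type*} {n d : ℕ} {W : Matrix (Fin n) (Fin n) ℝ} {R : ℕ} {γ : ℝ} {x0 : Vec d}
  {G : Fin n → Vec d → Ξ → Vec d} {ξ : Fin n → ℕ → ℕ → Ω → Ξ} {f : Fin n → Vec d → ℝ}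

/-- The push-sum weights are deterministic, so each `w_i` after the start is a constant multiple of
`x_i` and inherits its measurability and square integrability. -/
theorem mgPushDIGing_v (W : Matrix (Fin n) (Fin n) ℝ) (R : ℕ) (γ : ℝ) (x0 : Vec d)
    (G : Fin n → Vec d → Ξ → Vec d) (ξ : Fin n → ℕ → ℕ → Ω → Ξ) (ω : Ω) (k : ℕ) :
    (mgPushDIGing W R γ x0 G ξ ω k).v = (gossip W R)^[k] fun _ => 1 := by
  induction k with
  | zero => rfl
  | succ k ih => rw [Function.iterate_succ_apply', ← ih]; rfl

/-- The error of a single stochastic gradient. -/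
noncomputable def sampleNoise (W : Matrix (Fin n) (Fin n) ℝ) (R : ℕ) (γ : ℝ) (x0 : Vec d)
    (G : Fin n → Vec d → Ξ → Vec d) (ξ : Fin n → ℕ → ℕ → Ω → Ξ) (f : Fin n → Vec d → ℝ)
    (p : Fin n × ℕ × ℕ) (ω : Ω) : Vec d :=
  G p.1 ((mgPushDIGing W R γ x0 G ξ ω p.2.1).w p.1) (ξ p.1 p.2.1 p.2.2 ω) -
    gradient (f p.1) ((mgPushDIGing W R γ x0 G ξ ω p.2.1).w p.1)

theorem mgPushDIGing_g (ω : Ω) (k : ℕ) : (mgPushDIGing W R γ x0 G ξ ω k).g =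
    batchGrad R G ξ ω k (mgPushDIGing W R γ x0 G ξ ω k).w := by
  cases k <;> rfl

theorem noise_eq (hR : R ≠ 0) (ω : Ω) (k : ℕ) (i : Fin n) :
    (mgPushDIGing W R γ x0 G ξ ω k).noise f i =
      (R : ℝ)⁻¹ • ∑ r ∈ Finset.range R, sampleNoise W R γ x0 G ξ f (i, k, r) ω := by
  have hR' : (R : ℝ) ≠ 0 := by exact_mod_cast hR
  rw [State.noise, mgPushDIGing_g]
  simp only [batchGrad, sampleNoise, Finset.sum_sub_distrib, Finset.sum_const, Finset.card_range]
  rw [smul_sub, ← Nat.cast_smul_eq_nsmul ℝ, smul_smul, inv_mul_cancel₀ hR', one_smul]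

theorem avgNoise_eq (hR : R ≠ 0) (ω : Ω) (k : ℕ) :
    (mgPushDIGing W R γ x0 G ξ ω k).avgNoise f = (n * R : ℝ)⁻¹ •
      ∑ a ∈ Finset.univ ×ˢ Finset.range R,
        sampleNoise W R γ x0 G ξ f (a.1, k, a.2) ω := by
  simp only [State.avgNoise, noise_eq hR, Finset.sum_product, ← Finset.smul_sum]
  rw [smul_smul, mul_inv]

end Samples

section Measurability

/-! ### Measurability of the iterates -/

variable {Ω Ξ : Type*} {n d : ℕ} [MeasurableSpace Ω] [MeasurableSpace Ξ]
  {W : Matrix (Fin n) (Fin n) ℝ} {R : ℕ} {γ : ℝ} {x0 : Vec d} {G : Fin n → Vec d → Ξ → Vec d}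
  {ξ : Fin n → ℕ → ℕ → Ω → Ξ}

theorem measurable_gossip {z : Ω → Fin n → Vec d} (hz : ∀ i, Measurable fun ω => z ω i) (R : ℕ)
    (i : Fin n) : Measurable fun ω => gossip W R (z ω) i := by
  induction R generalizing i with
  | zero => exact hz i
  | succ R ih =>
    simp only [gossip_succ, wProtocol]
    exact Finset.measurable_sum _ fun j _ => measurable_smul_vec _ (ih j)

theorem memLp_gossip {μ : Measure Ω} {z : Ω → Fin n → Vec d}
    (hz : ∀ i, MemLp (fun ω => z ω i) 2 μ) (R : ℕ) (i : Fin n) :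
    MemLp (fun ω => gossip W R (z ω) i) 2 μ := by
  induction R generalizing i with
  | zero => exact hz i
  | succ R ih =>
    simp only [gossip_succ, wProtocol]
    exact memLp_finsetSum _ fun j _ => memLp_smul_vec _ (ih j)

theorem measurable_batchGrad (hG : ∀ i, Measurable (Function.uncurry (G i))) {k : ℕ}
    (hξ : ∀ i r, Measurable (ξ i k r)) {w : Ω → Fin n → Vec d}
    (hw : ∀ i, Measurable fun ω => w ω i) (i : Fin n) :
    Measurable fun ω => batchGrad R G ξ ω k (w ω) i := by
  simp only [batchGrad]
  refine measurable_smul_vec _ (Finset.measurable_sum _ fun r _ => ?_)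
  exact (hG i).comp ((hw i).prodMk (hξ i r))

/-- The models before querying the oracles at iteration `k` depend on the samples of the earlier
iterations only. -/
theorem measurable_mgPushDIGing (hG : ∀ i, Measurable (Function.uncurry (G i))) (k : ℕ) :
    ((∀ i k' r, k' < k → Measurable (ξ i k' r)) →
      (∀ i, Measurable fun ω => (mgPushDIGing W R γ x0 G ξ ω k).x i) ∧
      ∀ i, Measurable fun ω => (mgPushDIGing W R γ x0 G ξ ω k).w i) ∧
    ((∀ i k' r, k' ≤ k → Measurable (ξ i k' r)) →
      (∀ i, Measurable fun ω => (mgPushDIGing W R γ x0 G ξ ω k).g i) ∧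
      ∀ i, Measurable fun ω => (mgPushDIGing W R γ x0 G ξ ω k).y i) := by
  induction k with
  | zero =>
    refine ⟨fun _ => ⟨fun _ => measurable_const, fun _ => measurable_const⟩, fun hξ => ?_⟩
    have h := measurable_batchGrad (R := R) (w := fun _ _ => x0) hG (fun i r => hξ i 0 r le_rfl)
      fun _ => measurable_const
    exact ⟨h, h⟩
  | succ k ih =>
    have hxw : (∀ i k' r, k' < k + 1 → Measurable (ξ i k' r)) →
        (∀ i, Measurable fun ω => (mgPushDIGing W R γ x0 G ξ ω (k + 1)).x i) ∧
        ∀ i, Measurable fun ω => (mgPushDIGing W R γ x0 G ξ ω (k + 1)).w i := fun hξ => by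
      have h1 := (ih.1 fun i k' r hk => hξ i k' r (by omega)).1
      have h2 := (ih.2 fun i k' r hk => hξ i k' r (by omega)).2
      have hx : ∀ i, Measurable fun ω => (mgPushDIGing W R γ x0 G ξ ω (k + 1)).x i :=
        measurable_gossip (fun i => (h1 i).sub ((h2 i).const_smul γ)) R
      refine ⟨hx, fun i => ?_⟩
      have h3 : (fun ω => (mgPushDIGing W R γ x0 G ξ ω (k + 1)).w i) = fun ω =>
          ((gossip W R)^[k + 1] (fun _ => (1 : ℝ)) i)⁻¹ •
            (mgPushDIGing W R γ x0 G ξ ω (k + 1)).x i := by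
        ext1 ω
        rw [← mgPushDIGing_v W R γ x0 G ξ ω]
        rfl
      rw [h3]
      exact measurable_smul_vec _ (hx i)
    refine ⟨hxw, fun hξ => ?_⟩
    have hw := (hxw fun i k' r hk => hξ i k' r (by omega)).2
    have hg : ∀ i, Measurable fun ω => (mgPushDIGing W R γ x0 G ξ ω (k + 1)).g i :=
      measurable_batchGrad hG (fun i r => hξ i _ r le_rfl) hw
    have h1 := ih.2 fun i k' r hk => hξ i k' r (by omega)
    exact ⟨hg, measurable_gossip (fun i => ((h1.2 i).add (hg i)).sub (h1.1 i)) R⟩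

theorem measurable_avg {z : Ω → State n d} (hz : ∀ i, Measurable fun ω => (z ω).x i) :
    Measurable fun ω => (z ω).avg :=
  measurable_smul_vec _ (Finset.measurable_sum _ fun i _ => hz i)

end Measurability

/-! ### The information carried by all samples but one -/

section OtherSamples

variable {Ω Ξ : Type*} {n d : ℕ} [MeasurableSpace Ξ] {W : Matrix (Fin n) (Fin n) ℝ} {R : ℕ}
  {γ : ℝ} {x0 : Vec d} {G : Fin n → Vec d → Ξ → Vec d} {ξ : Fin n → ℕ → ℕ → Ω → Ξ}
  {D : Fin n → Measure Ξ} {f : Fin n → Vec d → ℝ} {σ : ℝ}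

/-- The `σ`-algebra of all the samples but one. -/
@[reducible]
def otherSamples (ξ : Fin n → ℕ → ℕ → Ω → Ξ) (p : Fin n × ℕ × ℕ) : MeasurableSpace Ω :=
  ⨆ q ∈ ({p}ᶜ : Set (Fin n × ℕ × ℕ)), MeasurableSpace.comap (ξ q.1 q.2.1 q.2.2) inferInstance

theorem measurable_otherSamples {p q : Fin n × ℕ × ℕ} (h : q ≠ p) :
    Measurable[otherSamples ξ p] (ξ q.1 q.2.1 q.2.2) := by
  rw [measurable_iff_comap_le]
  exact le_iSup₂_of_le (f := fun (q : Fin n × ℕ × ℕ) (_ : q ∈ ({p}ᶜ : Set (Fin n × ℕ × ℕ))) =>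
    MeasurableSpace.comap (ξ q.1 q.2.1 q.2.2) inferInstance) q h le_rfl

theorem measurable_otherSamples_state (hO : ∀ i, IsGradientOracle (f i) (D i) (G i) σ)
    {p : Fin n × ℕ × ℕ} {k : ℕ} (hk : k ≤ p.2.1) :
    (∀ i, Measurable[otherSamples ξ p] fun ω => (mgPushDIGing W R γ x0 G ξ ω k).x i) ∧
      ∀ i, Measurable[otherSamples ξ p] fun ω => (mgPushDIGing W R γ x0 G ξ ω k).w i := by
  -- Measurability of the iterates is applied with `otherSamples ξ p` as the `σ`-algebra on `Ω`:
  -- only samples of iterations before `k ≤ p.2.1` enter, and `p` is not one of them.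
  refine (@measurable_mgPushDIGing Ω Ξ n d (otherSamples ξ p) _ W R γ x0 G ξ
    (fun i => (hO i).measurable) k).1 fun i k' r hk' => ?_
  refine measurable_otherSamples (p := p) (q := (i, k', r)) fun h => ?_
  rw [← h] at hk
  exact absurd hk' (not_lt.2 hk)

end OtherSamples

section Noise

/-! ### Moments of the gradient noise -/

variable {Ω Ξ : Type*} {n d : ℕ} [mΩ : MeasurableSpace Ω] [MeasurableSpace Ξ]
  {W : Matrix (Fin n) (Fin n) ℝ} {R : ℕ} {γ : ℝ} {x0 : Vec d} {G : Fin n → Vec d → Ξ → Vec d}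
  {ξ : Fin n → ℕ → ℕ → Ω → Ξ} {μ : Measure Ω} {D : Fin n → Measure Ξ}
  {f : Fin n → Vec d → ℝ} {L Δ σ : ℝ}

theorem otherSamples_le (hS : IsSampling μ D ξ) (p : Fin n × ℕ × ℕ) : otherSamples ξ p ≤ mΩ :=
  iSup₂_le fun _ _ => (hS.measurable _ _ _).comap_le

theorem indepFun_of_otherSamples {E : Type*} [MeasurableSpace E] (hS : IsSampling μ D ξ)
    {p : Fin n × ℕ × ℕ} {X : Ω → E} (hX : Measurable[otherSamples ξ p] X) :
    IndepFun X (ξ p.1 p.2.1 p.2.2) μ := by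
  have h := indep_iSup_of_disjoint (fun q => (hS.measurable _ _ _).comap_le) hS.indep.iIndep
    (disjoint_compl_left (a := ({p} : Set (Fin n × ℕ × ℕ))))
  simp only [Set.mem_singleton_iff, iSup_iSup_eq_left] at h
  rw [IndepFun_iff_Indep]
  exact indep_of_indep_of_le_left h (measurable_iff_comap_le.1 hX)

variable [IsProbabilityMeasure μ]

theorem memLp_comp_of_norm_sub_le {h : Vec d → Vec d} (hL : 0 ≤ L)
    (hh : ∀ x y, ‖h x - h y‖ ≤ L * ‖x - y‖) {X : Ω → Vec d} (hX : MemLp X 2 μ) :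
    MemLp (fun ω => h (X ω)) 2 μ := by
  have h1 : MemLp (fun ω => h (X ω) - h 0) 2 μ := by
    refine MemLp.of_le_mul (c := L) hX ?_ (Filter.Eventually.of_forall fun ω => ?_)
    · exact ((continuous_of_norm_sub_le hL hh).comp_aestronglyMeasurable hX.1).sub
        aestronglyMeasurable_const
    · simpa using hh (X ω) 0
  refine (h1.add (memLp_const (h 0))).congr_norm ?_ (Filter.Eventually.of_forall fun ω => ?_)
  · exact (continuous_of_norm_sub_le hL hh).comp_aestronglyMeasurable hX.1
  · simp

variable (W R γ)

theorem sampleNoise_sq (hf : IsSmoothProblem f x0 L Δ) (hL : 0 ≤ L)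
    (hO : ∀ i, IsGradientOracle (f i) (D i) (G i) σ) (hS : IsSampling μ D ξ)
    (p : Fin n × ℕ × ℕ) : MemLp (sampleNoise W R γ x0 G ξ f p) 2 μ ∧
      ∫ ω, ‖sampleNoise W R γ x0 G ξ f p ω‖ ^ 2 ∂μ ≤ σ ^ 2 := by
  have hw := (measurable_otherSamples_state (W := W) (R := R) (γ := γ) (x0 := x0) (ξ := ξ) hO
    (le_refl p.2.1)).2 p.1
  have hgr := (continuous_of_norm_sub_le hL (hf.lipschitz p.1)).measurable
  have hw' := hw.mono (otherSamples_le hS p) le_rfl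
  have hξ := hS.measurable p.1 p.2.1 p.2.2
  have hh : Measurable (Function.uncurry fun x s => G p.1 x s - gradient (f p.1) x) :=
    (hO p.1).measurable.sub (hgr.comp measurable_fst)
  have h1 := integrable_fresh (h := fun x s => G p.1 x s - gradient (f p.1) x) (c := σ ^ 2) hw' hξ
    (indepFun_of_otherSamples hS hw) hh
    (by rw [hS.law]; exact (hO p.1).integrable_sq) (by rw [hS.law]; exact (hO p.1).variance_le)
  refine ⟨(memLp_two_iff_integrable_sq_norm ?_).2 h1.1, h1.2⟩
  exact (hh.comp (hw'.prodMk hξ)).aestronglyMeasurable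

/-- With `V` and the query point frozen together as one variable independent of the sample,
unbiasedness makes the inner integral zero. -/
theorem integral_inner_sampleNoise (hf : IsSmoothProblem f x0 L Δ) (hL : 0 ≤ L)
    (hO : ∀ i, IsGradientOracle (f i) (D i) (G i) σ) (hS : IsSampling μ D ξ)
    (p : Fin n × ℕ × ℕ) {V : Ω → Vec d} (hV : Measurable[otherSamples ξ p] V)
    (hV2 : MemLp V 2 μ) :
    ∫ ω, (inner ℝ (V ω) (sampleNoise W R γ x0 G ξ f p ω) : ℝ) ∂μ = 0 := by
  have hw := (measurable_otherSamples_state (W := W) (R := R) (γ := γ) (x0 := x0) (ξ := ξ) hO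
    (le_refl p.2.1)).2 p.1
  have hgr := (continuous_of_norm_sub_le hL (hf.lipschitz p.1)).measurable
  have hξ := hS.measurable p.1 p.2.1 p.2.2
  have hX : Measurable[otherSamples ξ p]
      fun ω => (V ω, (mgPushDIGing W R γ x0 G ξ ω p.2.1).w p.1) := hV.prodMk hw
  have hD := hS.law p.1 p.2.1 p.2.2
  have hprob : IsProbabilityMeasure (D p.1) := by
    rw [← hD]
    exact Measure.isProbabilityMeasure_map hξ.aemeasurable
  refine integral_inner_fresh_eq_zero
    (h := fun (x : Vec d × Vec d) s => G p.1 x.2 s - gradient (f p.1) x.2) (V := Prod.fst)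
    (hX.mono (otherSamples_le hS p) le_rfl) hξ (indepFun_of_otherSamples hS hX) measurable_fst ?_
    ?_ ?_ (integrable_inner_of_memLp hV2 (sampleNoise_sq W R γ hf hL hO hS p).1)
  · exact ((hO p.1).measurable.comp ((measurable_snd.comp measurable_fst).prodMk
      measurable_snd)).sub (hgr.comp (measurable_snd.comp measurable_fst))
  · intro x
    rw [hD]
    exact ((hO p.1).integrable x.2).sub (integrable_const _)
  · intro x
    rw [hD, integral_sub ((hO p.1).integrable x.2) (integrable_const _), (hO p.1).unbiased]
    simp

theorem integral_inner_sampleNoise_sampleNoise (hf : IsSmoothProblem f x0 L Δ) (hL : 0 ≤ L)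
    (hO : ∀ i, IsGradientOracle (f i) (D i) (G i) σ) (hS : IsSampling μ D ξ)
    {p q : Fin n × ℕ × ℕ} (hqp : q ≠ p) (hk : q.2.1 = p.2.1) :
    ∫ ω, (inner ℝ (sampleNoise W R γ x0 G ξ f q ω) (sampleNoise W R γ x0 G ξ f p ω) : ℝ) ∂μ
      = 0 := by
  refine integral_inner_sampleNoise W R γ hf hL hO hS p ?_ (sampleNoise_sq W R γ hf hL hO hS q).1
  have hw := (measurable_otherSamples_state (W := W) (R := R) (γ := γ) (x0 := x0) (ξ := ξ) hO
    hk.le).2 q.1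
  have hgr := (continuous_of_norm_sub_le hL (hf.lipschitz q.1)).measurable
  exact ((hO q.1).measurable.comp (hw.prodMk (measurable_otherSamples hqp))).sub (hgr.comp hw)

variable {W R γ}

/-- The errors within a batch are pairwise orthogonal, since each is determined by samples other
than the next one's; averaging `R` of them divides the variance by `R`. -/
theorem integral_norm_noise_sq_le (hf : IsSmoothProblem f x0 L Δ) (hL : 0 ≤ L) (hR : R ≠ 0)
    (hO : ∀ i, IsGradientOracle (f i) (D i) (G i) σ) (hS : IsSampling μ D ξ) (k : ℕ)
    (i : Fin n) : MemLp (fun ω => (mgPushDIGing W R γ x0 G ξ ω k).noise f i) 2 μ ∧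
      ∫ ω, ‖(mgPushDIGing W R γ x0 G ξ ω k).noise f i‖ ^ 2 ∂μ ≤ σ ^ 2 / R := by
  have hR' : (R : ℝ) ≠ 0 := by exact_mod_cast hR
  simp only [noise_eq hR]
  refine ⟨memLp_smul_vec _ (memLp_finsetSum _ fun r _ => (sampleNoise_sq W R γ hf hL hO hS _).1),
    ?_⟩
  simp only [norm_smul, mul_pow, norm_inv, RCLike.norm_natCast]
  rw [integral_const_mul, integral_norm_sum_sq_of_orthogonal
    (e := fun r => sampleNoise W R γ x0 G ξ f (i, k, r)) (Finset.range R)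
    (fun r _ => (sampleNoise_sq W R γ hf hL hO hS _).1)
    (fun r _ r' _ hr => integral_inner_sampleNoise_sampleNoise W R γ hf hL hO hS
      (by simpa using hr) rfl)]
  calc _ ≤ (R : ℝ)⁻¹ ^ 2 * ∑ _r ∈ Finset.range R, σ ^ 2 := by
        gcongr
        exact (sampleNoise_sq W R γ hf hL hO hS _).2
    _ = σ ^ 2 / R := by
        simp only [Finset.sum_const, Finset.card_range, nsmul_eq_mul]
        field_simp

theorem integral_norm_avgNoise_sq_le (hf : IsSmoothProblem f x0 L Δ) (hL : 0 ≤ L) (hn : 1 ≤ n)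
    (hR : R ≠ 0) (hO : ∀ i, IsGradientOracle (f i) (D i) (G i) σ) (hS : IsSampling μ D ξ)
    (k : ℕ) : MemLp (fun ω => (mgPushDIGing W R γ x0 G ξ ω k).avgNoise f) 2 μ ∧
      ∫ ω, ‖(mgPushDIGing W R γ x0 G ξ ω k).avgNoise f‖ ^ 2 ∂μ ≤ σ ^ 2 / (n * R) := by
  have hR' : (R : ℝ) ≠ 0 := by exact_mod_cast hR
  have hn' : (n : ℝ) ≠ 0 := by positivity
  simp only [avgNoise_eq hR]
  refine ⟨memLp_smul_vec _ (memLp_finsetSum _ fun r _ => (sampleNoise_sq W R γ hf hL hO hS _).1),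
    ?_⟩
  simp only [norm_smul, mul_pow, norm_inv, norm_mul, RCLike.norm_natCast]
  rw [integral_const_mul, integral_norm_sum_sq_of_orthogonal
    (e := fun a : Fin n × ℕ => sampleNoise W R γ x0 G ξ f (a.1, k, a.2)) _
    (fun r _ => (sampleNoise_sq W R γ hf hL hO hS _).1)
    (fun a _ b _ hab => integral_inner_sampleNoise_sampleNoise W R γ hf hL hO hS
      (fun h => hab (by simp only [Prod.mk.injEq, true_and] at h; exact Prod.ext h.1 h.2)) rfl)]
  calc _ ≤ (n * R : ℝ)⁻¹ ^ 2 * ∑ _a ∈ (Finset.univ : Finset (Fin n)) ×ˢ Finset.range R, σ ^ 2 := by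
        gcongr
        exact (sampleNoise_sq W R γ hf hL hO hS _).2
    _ = σ ^ 2 / (n * R) := by
        simp only [Finset.sum_const, Finset.card_product, Finset.card_univ, Fintype.card_fin,
          Finset.card_range, nsmul_eq_mul]
        push_cast
        field_simp

theorem memLp_mgPushDIGing (hf : IsSmoothProblem f x0 L Δ) (hL : 0 ≤ L) (hR : R ≠ 0)
    (hO : ∀ i, IsGradientOracle (f i) (D i) (G i) σ) (hS : IsSampling μ D ξ) (k : ℕ) :
    (∀ i, MemLp (fun ω => (mgPushDIGing W R γ x0 G ξ ω k).x i) 2 μ) ∧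
    (∀ i, MemLp (fun ω => (mgPushDIGing W R γ x0 G ξ ω k).g i) 2 μ) ∧
    ∀ i, MemLp (fun ω => (mgPushDIGing W R γ x0 G ξ ω k).y i) 2 μ := by
  have hg : ∀ k, (∀ i, MemLp (fun ω => (mgPushDIGing W R γ x0 G ξ ω k).w i) 2 μ) →
      ∀ i, MemLp (fun ω => (mgPushDIGing W R γ x0 G ξ ω k).g i) 2 μ := fun k hw i => by
    have h1 := (integral_norm_noise_sq_le (W := W) (γ := γ) hf hL hR hO hS k i).1.add
      (memLp_comp_of_norm_sub_le hL (hf.lipschitz i) (hw i))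
    refine h1.congr_norm ?_ (Filter.Eventually.of_forall fun ω => ?_)
    · refine Measurable.aestronglyMeasurable ?_
      exact ((measurable_mgPushDIGing (fun i => (hO i).measurable) k).2
        fun i k' r _ => hS.measurable i k' r).1 i
    · simp [State.noise]
  induction k with
  | zero =>
    have h := hg 0 fun _ => memLp_const x0
    exact ⟨fun _ => memLp_const x0, h, h⟩
  | succ k ih =>
    have hx : ∀ i, MemLp (fun ω => (mgPushDIGing W R γ x0 G ξ ω (k + 1)).x i) 2 μ :=
      memLp_gossip (fun i => (ih.1 i).sub ((ih.2.2 i).const_smul γ)) R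
    have h := hg (k + 1) fun i => by
      have h3 : (fun ω => (mgPushDIGing W R γ x0 G ξ ω (k + 1)).w i) = fun ω =>
          ((gossip W R)^[k + 1] (fun _ => (1 : ℝ)) i)⁻¹ •
            (mgPushDIGing W R γ x0 G ξ ω (k + 1)).x i := by
        ext1 ω
        rw [← mgPushDIGing_v W R γ x0 G ξ ω]
        rfl
      rw [h3]
      exact memLp_smul_vec _ (hx i)
    exact ⟨hx, h, memLp_gossip (fun i => ((ih.2.2 i).add (h i)).sub (ih.2.1 i)) R⟩

theorem memLp_gradient_avg (hf : IsSmoothProblem f x0 L Δ) (hL : 0 ≤ L) (hn : 1 ≤ n) (hR : R ≠ 0)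
    (hO : ∀ i, IsGradientOracle (f i) (D i) (G i) σ) (hS : IsSampling μ D ξ) (k : ℕ) :
    MemLp (fun ω => gradient (globalObj f) (mgPushDIGing W R γ x0 G ξ ω k).avg) 2 μ :=
  memLp_comp_of_norm_sub_le hL (hf.lipschitz_globalObj hn)
    (memLp_smul_vec _ (memLp_finsetSum _ fun i _ => (memLp_mgPushDIGing hf hL hR hO hS k).1 i))

theorem integral_inner_avgNoise (hf : IsSmoothProblem f x0 L Δ) (hL : 0 ≤ L) (hn : 1 ≤ n)
    (hR : R ≠ 0) (hO : ∀ i, IsGradientOracle (f i) (D i) (G i) σ) (hS : IsSampling μ D ξ)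
    (k : ℕ) : ∫ ω, (inner ℝ (gradient (globalObj f) (mgPushDIGing W R γ x0 G ξ ω k).avg)
      ((mgPushDIGing W R γ x0 G ξ ω k).avgNoise f) : ℝ) ∂μ = 0 := by
  have hV := memLp_gradient_avg (W := W) (γ := γ) hf hL hn hR hO hS k
  simp only [avgNoise_eq hR, inner_smul_right, inner_sum]
  rw [integral_const_mul, integral_finsetSum _ fun a _ =>
    integrable_inner_of_memLp hV (sampleNoise_sq W R γ hf hL hO hS _).1]
  rw [Finset.sum_eq_zero, mul_zero]
  intro a _
  refine integral_inner_sampleNoise W R γ hf hL hO hS _ ?_ hV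
  refine (continuous_of_norm_sub_le hL (hf.lipschitz_globalObj hn)).measurable.comp ?_
  exact @measurable_avg Ω n d (otherSamples ξ (a.1, k, a.2)) _
    (measurable_otherSamples_state hO le_rfl).1

end Noise

end PushDIGing

namespace PushDIGing

section Rate

/-! ### Convergence in expectation and the step size -/

theorem IsSmoothProblem.gradient_eq_zero {n d : ℕ} {f : Fin n → Vec d → ℝ} {x0 : Vec d} {Δ : ℝ}
    (hf : IsSmoothProblem f x0 0 Δ) (hn : 1 ≤ n) (x : Vec d) : gradient (globalObj f) x = 0 := by
  obtain ⟨m, hm⟩ := hf.bddBelow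
  by_contra h
  set g := gradient (globalObj f) x
  have hg : 0 < ‖g‖ ^ 2 := by positivity
  -- With `L = 0` there is no quadratic penalty, so this step along `-g` would reach a value at most
  -- `m - 1`, below the lower bound `m`.
  have h1 := hf.descent hn le_rfl x (-(((globalObj f x - m + 1) / ‖g‖ ^ 2) • g))
  have h2 := hm ⟨_, rfl⟩ |>.trans h1
  rw [inner_neg_right, inner_smul_right, real_inner_self_eq_norm_sq, div_mul_cancel₀ _ hg.ne'] at h2
  linarith

theorem integral_le_of_le_affine {Ω : Type*} [MeasurableSpace Ω] {μ : Measure Ω}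
    [IsProbabilityMeasure μ] {a b₁ b₂ b₃ b₄ : Ω → ℝ} {c₀ c₁ c₂ c₃ c₄ : ℝ} (ha : Integrable a μ)
    (h₁ : Integrable b₁ μ) (h₂ : Integrable b₂ μ) (h₃ : Integrable b₃ μ) (h₄ : Integrable b₄ μ)
    (h : ∀ ω, a ω ≤ c₀ + c₁ * b₁ ω + c₂ * b₂ ω + c₃ * b₃ ω - c₄ * b₄ ω) :
    ∫ ω, a ω ∂μ ≤ c₀ + c₁ * ∫ ω, b₁ ω ∂μ + c₂ * ∫ ω, b₂ ω ∂μ + c₃ * ∫ ω, b₃ ω ∂μ -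
      c₄ * ∫ ω, b₄ ω ∂μ := by
  have i₁ := (integrable_const (μ := μ) c₀).add (h₁.const_mul c₁)
  have i₂ := i₁.add (h₂.const_mul c₂)
  have i₃ := i₂.add (h₃.const_mul c₃)
  refine (integral_mono ha (i₃.sub (h₄.const_mul c₄)) h).trans_eq ?_
  rw [integral_sub' i₃ (h₄.const_mul c₄), integral_add' i₂ (h₃.const_mul c₃),
    integral_add' i₁ (h₂.const_mul c₂), integral_add' (integrable_const c₀) (h₁.const_mul c₁)]
  simp [integral_const_mul]

theorem sum_integral_norm_gradient_sq_le {Ω Ξ : Type*} {n d : ℕ} [MeasurableSpace Ω]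
    [MeasurableSpace Ξ] {W : Matrix (Fin n) (Fin n) ℝ} {R : ℕ} {γ : ℝ} {x0 : Vec d}
    {G : Fin n → Vec d → Ξ → Vec d} {ξ : Fin n → ℕ → ℕ → Ω → Ξ} {μ : Measure Ω}
    [IsProbabilityMeasure μ] {D : Fin n → Measure Ξ} {f : Fin n → Vec d → ℝ} {L Δ σ Y : ℝ}
    {π : Fin n → ℝ} {ρ P : ℝ} (h : GossipBounds W π R ρ P) (hf : IsSmoothProblem f x0 L Δ)
    (hL : 0 ≤ L) (hR : R ≠ 0) (hO : ∀ i, IsGradientOracle (f i) (D i) (G i) σ)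
    (hS : IsSampling μ D ξ) (hγ : 0 < γ) (hγL : γ * L ≤ 1 / 6) (hY : initGradSq μ R x0 G ξ ≤ Y)
    (K : ℕ) :
    ∑ k ∈ Finset.range (K + 1),
      ∫ ω, ‖gradient (globalObj f) (mgPushDIGing W R γ x0 G ξ ω k).avg‖ ^ 2 ∂μ ≤
        2 * Δ / γ + 4 * γ ^ 2 * L ^ 2 / n ^ 5 * Y +
          8 * γ * L * ((K + 1) * (σ ^ 2 / (n * R))) := by
  have hn := h.card_pos
  have hn1 : (1 : ℝ) ≤ n := by exact_mod_cast hn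
  have hR0 : (0 : ℝ) < R := by positivity
  have sq {a : Ω → Vec d} (ha : MemLp a 2 μ) : Integrable (fun ω => ‖a ω‖ ^ 2) μ :=
    (memLp_two_iff_integrable_sq_norm ha.1).1 ha
  have iA := fun k => sq (memLp_gradient_avg (W := W) (γ := γ) hf hL hn hR hO hS k)
  have iN := fun k i => integral_norm_noise_sq_le (W := W) (γ := γ) hf hL hR hO hS k i
  have iB := fun k => integral_norm_avgNoise_sq_le (W := W) (γ := γ) hf hL hn hR hO hS k
  have iI := fun k => integrable_inner_of_memLp
    (memLp_gradient_avg (W := W) (γ := γ) hf hL hn hR hO hS k) (iB k).1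
  have iG := fun i => sq ((memLp_mgPushDIGing (W := W) (γ := γ) hf hL hR hO hS 0).2.1 i)
  have jG := integrable_finsetSum Finset.univ fun i _ => iG i
  have jN := fun k => integrable_finsetSum Finset.univ fun i _ => sq (iN k i).1
  have jNs := integrable_finsetSum (Finset.range (K + 1)) fun k _ => jN k
  have jB := integrable_finsetSum (Finset.range (K + 1)) fun k _ => sq (iB k).1
  have jI := integrable_finsetSum (Finset.range (K + 1)) fun k _ => iI k
  rw [← integral_finsetSum _ fun k _ => iA k]
  refine (integral_le_of_le_affine (integrable_finsetSum _ fun k _ => iA k) jG jNs jB jI fun ω =>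
    h.sum_norm_gradient_sq_le (isPushDIGing_mgPushDIGing W R γ x0 G ξ ω) hf hL hγ hγL K).trans ?_
  rw [integral_finsetSum _ fun k _ => iI k, integral_finsetSum _ fun k _ => jN k,
    integral_finsetSum _ fun k _ => sq (iB k).1]
  have e1 : ∑ k ∈ Finset.range (K + 1), ∫ ω, (inner ℝ
      (gradient (globalObj f) (mgPushDIGing W R γ x0 G ξ ω k).avg)
      ((mgPushDIGing W R γ x0 G ξ ω k).avgNoise f) : ℝ) ∂μ = 0 :=
    Finset.sum_eq_zero fun k _ => integral_inner_avgNoise hf hL hn hR hO hS k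
  have e2 : ∑ k ∈ Finset.range (K + 1), ∫ ω, ∑ i,
      ‖(mgPushDIGing W R γ x0 G ξ ω k).noise f i‖ ^ 2 ∂μ ≤ (K + 1) * (n * (σ ^ 2 / R)) := by
    refine (Finset.sum_le_card_nsmul _ _ (n * (σ ^ 2 / R)) fun k _ => ?_).trans_eq (by simp)
    rw [integral_finsetSum _ fun i _ => sq (iN k i).1]
    exact (Finset.sum_le_card_nsmul _ _ _ fun i _ => (iN k i).2).trans_eq (by simp)
  have e3 : ∑ k ∈ Finset.range (K + 1),
      ∫ ω, ‖(mgPushDIGing W R γ x0 G ξ ω k).avgNoise f‖ ^ 2 ∂μ ≤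
        (K + 1) * (σ ^ 2 / (n * R)) :=
    (Finset.sum_le_card_nsmul _ _ _ fun k _ => (iB k).2).trans_eq (by simp)
  have e4 : ∫ ω, ∑ i, ‖(mgPushDIGing W R γ x0 G ξ ω 0).g i‖ ^ 2 ∂μ ≤ Y := hY
  rw [e1]
  simp only [mul_zero, sub_zero]
  -- The local noise lacks the factor `1 / n` of the averaged noise, but it enters at second order
  -- in `γ` with `n ^ 3` in the denominator, so the averaged-noise term dominates it.
  have e5 : 12 * γ ^ 2 * L ^ 2 / n ^ 3 * ((K + 1) * (n * (σ ^ 2 / R))) ≤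
      2 * γ * L * ((K + 1) * (σ ^ 2 / (n * R))) := by
    have hγL0 : 0 ≤ γ * L := by positivity
    calc 12 * γ ^ 2 * L ^ 2 / n ^ 3 * ((K + 1) * (n * (σ ^ 2 / R)))
        = 12 * (γ * L) * ((γ * L) / n) * ((K + 1) * (σ ^ 2 / (n * R))) := by field_simp
      _ ≤ 12 * (γ * L) * ((1 / 6) / 1) * ((K + 1) * (σ ^ 2 / (n * R))) := by gcongr
      _ = _ := by ring
  calc _ ≤ 2 * Δ / γ + 4 * γ ^ 2 * L ^ 2 / n ^ 5 * Y +
        12 * γ ^ 2 * L ^ 2 / n ^ 3 * ((K + 1) * (n * (σ ^ 2 / R))) +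
        6 * L * γ * ((K + 1) * (σ ^ 2 / (n * R))) := by gcongr
    _ ≤ _ := by linarith

/-- The step size: the harmonic sum of the stability bound `1 / (6 L)` and of the values that
balance the optimization term against the noise and against the initial disagreement. -/
noncomputable def stepSize (n K R : ℕ) (L Δ σ Y : ℝ) : ℝ :=
  (6 * L + σ * √(L * (K + 1) / (n * R * Δ)) + L * (Y / (n * L * Δ)) ^ (1 / 3 : ℝ) / n)⁻¹

theorem stepSize_pos {n K R : ℕ} {L Δ σ Y : ℝ} (hL : 0 < L) (hΔ : 0 < Δ) (hσ : 0 ≤ σ)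
    (hY : 0 ≤ Y) : 0 < stepSize n K R L Δ σ Y := by
  rw [stepSize]
  positivity

/-- The bound for the harmonic step size `γ = (a + b + c)⁻¹`. -/
theorem bound_of_eq_inv_add {a b c γ Δ A B : ℝ} (ha : 0 < a) (hb : 0 ≤ b) (hc : 0 ≤ c)
    (hΔ : 0 ≤ Δ) (hγ : γ = (a + b + c)⁻¹) (hA : A ≤ c ^ 3 * Δ) (hB : B = b ^ 2 * Δ) :
    2 * Δ / γ + 4 * γ ^ 2 * A + 8 * γ * B ≤ 10 * (a + b + c) * Δ := by
  have hγ0 : 0 < γ := by rw [hγ]; positivity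
  have hs : γ * (a + b + c) = 1 := by
    rw [hγ]
    exact inv_mul_cancel₀ (by positivity)
  have hγb : γ * b ≤ 1 := by nlinarith [mul_pos hγ0 ha, mul_nonneg hγ0.le hc]
  have hγc : γ * c ≤ 1 := by nlinarith [mul_pos hγ0 ha, mul_nonneg hγ0.le hb]
  have h1 : 2 * Δ / γ = 2 * (a + b + c) * Δ := by
    rw [hγ, div_inv_eq_mul]
    ring
  have h2 : γ ^ 2 * A ≤ c * Δ := by
    calc γ ^ 2 * A ≤ γ ^ 2 * (c ^ 3 * Δ) := by gcongr
      _ = (γ * c) ^ 2 * (c * Δ) := by ring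
      _ ≤ 1 ^ 2 * (c * Δ) := by gcongr
      _ = c * Δ := by ring
  have h3 : γ * B ≤ b * Δ := by
    calc γ * B = γ * b * (b * Δ) := by rw [hB]; ring
      _ ≤ 1 * (b * Δ) := by gcongr
      _ = b * Δ := one_mul _
  have h4 : 0 ≤ a * Δ := by positivity
  have h5 : 0 ≤ c * Δ := by positivity
  rw [h1]
  linarith

theorem rate_of_stepSize {n K R : ℕ} {L Δ σ κ β Y A : ℝ} (hn : 1 ≤ n) (hL : 0 < L) (hΔ : 0 < Δ)
    (hσ : 0 ≤ σ) (hY : 0 ≤ Y) (hκ : 1 ≤ κ) (hβ0 : 0 ≤ β) (hβ : β < 1)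
    (hR : R = gossipRounds n κ β) (hR0 : R ≠ 0)
    (hA : A ≤ 2 * Δ / stepSize n K R L Δ σ Y +
      4 * stepSize n K R L Δ σ Y ^ 2 * L ^ 2 / n ^ 5 * Y +
        8 * stepSize n K R L Δ σ Y * L * ((K + 1) * (σ ^ 2 / (n * R)))) :
    1 / (K + 1 : ℝ) * A ≤ 840 * (σ * √(L * Δ) / √(n * ((K + 1) * R)) +
      (1 + Real.log n + (Y / (n * L * Δ)) ^ (1 / 3 : ℝ)) *
        ((1 + Real.log κ) * L * Δ / ((1 - β) * ((K + 1) * R)))) := by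
  have hn1 : (1 : ℝ) ≤ n := by exact_mod_cast hn
  have hn0 : (0 : ℝ) < n := by linarith
  have hR1 : (0 : ℝ) < R := by positivity
  have hlκ : 0 ≤ Real.log κ := Real.log_nonneg hκ
  have hln : 0 ≤ Real.log n := Real.log_nonneg hn1
  have hβ1 : 0 < 1 - β := by linarith
  have hRle := gossipRounds_le hn hκ hβ0 hβ
  rw [← hR] at hRle
  set N : ℝ := (K : ℝ) + 1 with hN
  have hN0 : 0 < N := by positivity
  set y : ℝ := (Y / (n * L * Δ)) ^ (1 / 3 : ℝ) with hy
  have hy0 : 0 ≤ y := by positivity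
  have hy3 : y ^ 3 = Y / (n * L * Δ) := by
    rw [hy, ← Real.rpow_natCast, ← Real.rpow_mul (by positivity)]
    norm_num
  set b : ℝ := σ * √(L * N / (n * R * Δ)) with hb
  have hb2 : b ^ 2 = σ ^ 2 * (L * N / (n * R * Δ)) := by
    rw [hb, mul_pow, Real.sq_sqrt (by positivity)]
  have h1 := bound_of_eq_inv_add (a := 6 * L) (b := b) (c := L * y / n)
    (γ := stepSize n K R L Δ σ Y) (Δ := Δ) (A := L ^ 2 / n ^ 5 * Y)
    (B := L * (N * (σ ^ 2 / (n * R)))) (by positivity) (by positivity) (by positivity) hΔ.le rfl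
    -- The cube root in the step size makes `c ^ 3 * Δ` equal to `L ^ 2 / n ^ 4 * Y`, which leaves a
    -- factor `n` to spare.
    (by
      have h2 : (L * y / n) ^ 3 * Δ = L ^ 2 / n ^ 4 * Y := by
        rw [div_pow, mul_pow, hy3]
        field_simp
      rw [h2]
      gcongr
      · norm_num)
    (by rw [hb2]; field_simp)
  have h2 : A ≤ 10 * (6 * L + b + L * y / n) * Δ := by
    refine hA.trans (le_trans (le_of_eq ?_) h1)
    ring
  have h3 : b * Δ / N = σ * √(L * Δ) / √(n * (N * R)) := by
    have h4 : √(L * N / (n * R * Δ)) = √(L * Δ) / √(n * (N * R)) * (N / Δ) := by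
      rw [← Real.sqrt_div (by positivity)]
      conv_rhs => rw [← Real.sqrt_sq (by positivity : 0 ≤ N / Δ)]
      rw [← Real.sqrt_mul (by positivity)]
      congr 1
      field_simp
    rw [hb, h4]
    field_simp
  have h5 : (6 * L + L * y / n) * Δ / N ≤ 84 * ((1 + Real.log n + y) *
      ((1 + Real.log κ) * L * Δ / ((1 - β) * (N * R)))) := by
    -- The `1 / n` in front of `y` absorbs the logarithm from the bound on `R`, because `1 + log n ≤
    -- n`; thus `log n` and `y` add instead of multiplying. The final constant is `840 = 10 * 14 *
    -- 6`.
    have h6 : (6 + y / n) * (1 + Real.log n) ≤ 6 * (1 + Real.log n + y) := by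
      have h7 : 1 + Real.log n ≤ n := by linarith [Real.log_le_sub_one_of_pos hn0]
      have h8 : y / n * (1 + Real.log n) ≤ y := by
        rw [div_mul_eq_mul_div, div_le_iff₀ hn0]
        gcongr
      linarith
    calc (6 * L + L * y / n) * Δ / N = (6 + y / n) * (L * Δ / (N * R)) * R := by
          field_simp
      _ ≤ (6 + y / n) * (L * Δ / (N * R)) *
          (14 * (1 + Real.log κ) * (1 + Real.log n) / (1 - β)) := by gcongr
      _ = 14 * ((6 + y / n) * (1 + Real.log n)) *
          ((1 + Real.log κ) * L * Δ / ((1 - β) * (N * R))) := by field_simp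
      _ ≤ 14 * (6 * (1 + Real.log n + y)) *
          ((1 + Real.log κ) * L * Δ / ((1 - β) * (N * R))) := by gcongr
      _ = _ := by ring
  have h6 : 0 ≤ σ * √(L * Δ) / √(n * (N * R)) := by positivity
  calc 1 / N * A ≤ 1 / N * (10 * (6 * L + b + L * y / n) * Δ) := by gcongr
    _ = 10 * (b * Δ / N) + 10 * ((6 * L + L * y / n) * Δ / N) := by field_simp; ring
    _ ≤ _ := by rw [h3]; linarith

end Rate

end PushDIGing

/-! ### The convergence rate -/

open PushDIGing in
theorem theorem3 :
    ∃ C : ℝ, 0 < C ∧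
      ∀ (n K : ℕ) (L Δ σ κ β Y : ℝ), 1 ≤ n → 0 ≤ L → 0 < Δ → 0 ≤ σ → β < 1 →
      -- the step size depends only on the parameters above
      ∃ γ : ℝ, 0 < γ ∧
        ∀ (W : Matrix (Fin n) (Fin n) ℝ) (π : Fin n → ℝ),
          IsMixingMatrix W → IsEquilibrium W π → betaPi W π = β → kappaPi π = κ →
        ∀ (d : ℕ) (f : Fin n → Vec d → ℝ) (x0 : Vec d), IsSmoothProblem f x0 L Δ →
        ∀ (Ω Ξ : Type*) [MeasurableSpace Ω] [MeasurableSpace Ξ] (μ : Measure Ω)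
          [IsProbabilityMeasure μ] (D : Fin n → Measure Ξ) (G : Fin n → Vec d → Ξ → Vec d)
          (ξ : Fin n → ℕ → ℕ → Ω → Ξ),
          (∀ i, IsGradientOracle (f i) (D i) (G i) σ) → IsSampling μ D ξ →
        ∀ (R : ℕ) (T : ℝ), R = gossipRounds n κ β → T = (K + 1) * R →
          initGradSq μ R x0 G ξ ≤ Y →
          (∀ k ∈ Finset.range (K + 1), Integrable (fun ω =>
            ‖gradient (globalObj f) (mgPushDIGing W R γ x0 G ξ ω k).avg‖ ^ 2) μ) ∧
          (1 / (K + 1 : ℝ)) * ∑ k ∈ Finset.range (K + 1),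
              ∫ ω, ‖gradient (globalObj f) (mgPushDIGing W R γ x0 G ξ ω k).avg‖ ^ 2 ∂μ
            ≤ C * (σ * √(L * Δ) / √(n * T) +
                (1 + Real.log n + (Y / (n * L * Δ)) ^ (1 / 3 : ℝ)) *
                  ((1 + Real.log κ) * L * Δ / ((1 - β) * T))) := by
  refine ⟨840, by norm_num, fun n K L Δ σ κ β Y hn hL hΔ hσ hβ => ?_⟩
  -- A negative `Y` admits no instance. For `L = 0` a lower-bounded `f` has zero gradient
  -- everywhere. In both cases any step size works.
  rcases lt_or_ge Y 0 with hY | hY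
  · refine ⟨1, one_pos, ?_⟩
    intro W π _ _ _ _ d f x0 _ Ω Ξ _ _ μ _ D G ξ _ _ R T _ _ hinit
    have h0 : 0 ≤ initGradSq μ R x0 G ξ :=
      integral_nonneg fun ω => Finset.sum_nonneg fun i _ => sq_nonneg _
    exact absurd (h0.trans hinit) (not_le.2 hY)
  rcases hL.eq_or_lt with rfl | hL0
  · refine ⟨1, one_pos, ?_⟩
    intro W π _ _ _ _ d f x0 hf Ω Ξ _ _ μ _ D G ξ _ _ R T _ _ _
    simp [hf.gradient_eq_zero hn]
  · refine ⟨stepSize n K (gossipRounds n κ β) L Δ σ Y, stepSize_pos hL0 hΔ hσ hY, ?_⟩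
    intro W π hW hπ hβπ hκπ d f x0 hf Ω Ξ _ _ μ _ D G ξ hO hS R T hR hT hinit
    subst hT
    rw [← hR]
    have hβ0 : 0 ≤ β := hβπ ▸ betaPi_nonneg W π
    have hκ : 1 ≤ κ := hκπ ▸ hπ.one_le_kappaPi hn
    have hgb := gossipBounds hn hW hπ (hβπ ▸ hβ)
    rw [hβπ, hκπ, ← hR] at hgb
    -- An empty batch would not average to an unbiased gradient; the lower bound on `R` would read
    -- `2 ≤ 0`.
    have hR0 : R ≠ 0 := by
      rintro rfl
      have h1 := le_gossipRounds hn hκ hβ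
      rw [← hR] at h1
      have h2 := Real.log_nonneg hκ
      have h3 : 0 ≤ Real.log n := Real.log_nonneg (by exact_mod_cast hn)
      norm_num at h1
      linarith
    have hγ : 0 < stepSize n K R L Δ σ Y := stepSize_pos hL0 hΔ hσ hY
    have hγL : stepSize n K R L Δ σ Y * L ≤ 1 / 6 := by
      rw [stepSize, inv_mul_le_iff₀ (by positivity)]
      have h1 : 0 ≤ σ * √(L * (K + 1) / (n * R * Δ)) := by positivity
      have h2 : 0 ≤ L * (Y / (n * L * Δ)) ^ (1 / 3 : ℝ) / n := by positivity
      linarith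
    refine ⟨fun k _ => ?_, ?_⟩
    · have h := memLp_gradient_avg (W := W) (γ := stepSize n K R L Δ σ Y) hf hL hn hR0 hO hS k
      exact (memLp_two_iff_integrable_sq_norm h.1).1 h
    · exact rate_of_stepSize hn hL0 hΔ hσ hY hκ hβ0 hβ hR hR0
        (sum_integral_norm_gradient_sq_le hgb hf hL hR0 hO hS hγ hγL hinit K)
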